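/- Let $n\ge 0$ and let $U\Subset\Omega\subset\mathbb{R}^n$ be open sets (i.e. $\overline U$ is compact and contained in $\Omega$). Let $\eta_{\log}(r)=r\log\frac1r$ for $0<r\le\frac1e$ and $\eta_{\log}(r)=\frac1e$ for $r\ge\frac1e$, and let $C^{\log}(\Omega,\mathbb{R}^n)$ be the space of bounded maps $f:\Omega\to\mathbb{R}^n$ for which there is $C$ with $|f(x)-f(y)|\le C\,\eta_{\log}(|x-y|)$ for all distinct $x,y\in\Omega$. Let $X,Y\in C^{\log}(\Omega,\mathbb{R}^n)$ be vector fields such that $[X,Y]=0$ in the sense of distributions, i.e. $\sum_{i=1}^n\big(X^i\,\partial_iY^j-Y^i\,\partial_iX^j\big)=0$ in $\mathcal{D}'(\Omega)$ for $1\le j\le n$. Here the derivatives are distributional, and the product $fG$ of a function $f$ and a distribution $G$ on $\Omega$ is the limit in $\mathcal{D}'(\Omega)$ of $f_\nu g_\nu$, where $f_\nu,g_\nu\in C^\infty(\Omega)$, $f_\nu\to f$ in $C^{0,\alpha}_{\mathrm{loc}}(\Omega)$ and $g_\nu\to G$ in $C^{-1,\beta}_{\mathrm{loc}}(\Omega)$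 for some $\alpha,\beta\in(0,1)$ with $\alpha+\beta>1$. Convergence $g_\nu\to G$ in $C^{-1,\beta}_{\mathrm{loc}}(\Omega)$ means that on every open $V\Subset\Omega$ one can write $g_\nu-G=a_\nu+\operatorname{div}A_\nu$ with $a_\nu\to0$ in $C^{0,\beta}(V)$ and $A_\nu\to0$ in $C^{0,\beta}(V,\mathbb{R}^n)$. For a vector field $Z$ on $\Omega$, let $\mathfrak{F}_Z^t(p)=\gamma(t)$, where $\gamma$ is the unique maximal solution in $\Omega$ of $\gamma'=Z(\gamma)$, $\gamma(0)=p$; this is said to be defined at $(t,p)$ if $\gamma$ exists and its interval of existence contains $t$. Then there is an $\varepsilon_0>0$ such that for all $t,s\in\mathbb{R}$ with $|t|,|s|<\varepsilon_0$ the two maps $\mathfrak{F}_X^t\circ\mathfrak{F}_Y^s,\ \mathfrak{F}_Y^s\circ\mathfrak{F}_X^t:U\to\Omega$ are both defined on all of $U$ and equal. -/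

import Mathlib

open Set Filter Topology MeasureTheory TopologicalSpace
open scoped Distributions ContDiff LineDeriv

noncomputable section

namespace LogLipFlow

/-- The modulus `η_log(r) = r log (1/r)` for `0 < r ≤ 1/e`, and `η_log(r) = 1/e` for `r ≥ 1/e`
(and `η_log(0) = 0`). -/
def etaLog (r : ℝ) : ℝ :=
  if r ≤ (Real.exp 1)⁻¹ then r * Real.log (1 / r) else (Real.exp 1)⁻¹

section Regularity

variable {E F : Type*} [NormedAddCommGroup E] [NormedAddCommGroup F]

/-- `f ∈ C^log(Ω)`: `f` is bounded on `Ω` and `|f x - f y| ≤ C η_log(|x - y|)` on `Ω`. Such an `f` is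
uniformly continuous on `Ω`, hence (for complete `F`) extends continuously to the closure of `Ω`. -/
def IsLogLipschitz (Ω : Opens E) (f : E → F) : Prop :=
  ∃ C : ℝ, (∀ x ∈ Ω, ‖f x‖ ≤ C) ∧ ∀ x ∈ Ω, ∀ y ∈ Ω, ‖f x - f y‖ ≤ C * etaLog ‖x - y‖

/-- The supremum norm and the `α`-Hölder seminorm of `f` on `S` are both at most `C`. -/
def HolderBound (S : Set E) (α : ℝ) (f : E → F) (C : ℝ) : Prop :=
  (∀ x ∈ S, ‖f x‖ ≤ C) ∧ ∀ x ∈ S, ∀ y ∈ S, ‖f x - f y‖ ≤ C * ‖x - y‖ ^ α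

/-- `V ⋐ Ω`: the closure of `V` is compact and contained in `Ω`. -/
def CompactlyInside (V Ω : Opens E) : Prop :=
  IsCompact (closure (V : Set E)) ∧ closure (V : Set E) ⊆ Ω

/-- `f_ν → f` in `C^{0,α}_loc(Ω)`: convergence in the norm of `C^{0,α}(V)` for every open
`V ⋐ Ω`. -/
def TendstoHolderLoc (Ω : Opens E) (α : ℝ) (f : ℕ → E → F) (f₀ : E → F) : Prop :=
  ∀ V : Opens E, CompactlyInside V Ω →
    ∃ ε : ℕ → ℝ, Tendsto ε atTop (𝓝 0) ∧ ∀ ν, HolderBound (V : Set E) α (f ν - f₀) (ε ν)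

end Regularity

section Distributions

variable {n : ℕ}

/-- The distribution on `Ω` given by a function that is locally integrable on `Ω`
(and `0` if the function is not). -/
def toDistribution (Ω : Opens (EuclideanSpace ℝ (Fin n))) (f : EuclideanSpace ℝ (Fin n) → ℝ) :
    𝓓'(Ω, ℝ) :=
  (TestFunction.integralAgainstBilinCLM (ContinuousLinearMap.mul ℝ ℝ) volume f :
    𝓓(Ω, ℝ) →L[ℝ] ℝ)

lemma toDistribution_apply {Ω : Opens (EuclideanSpace ℝ (Fin n))}
    {f : EuclideanSpace ℝ (Fin n) → ℝ} (hf : LocallyIntegrableOn f Ω volume) (φ : 𝓓(Ω, ℝ)) :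
    toDistribution Ω f φ = ∫ x, φ x * f x := by
  change TestFunction.integralAgainstBilinCLM (ContinuousLinearMap.mul ℝ ℝ) volume f φ = _
  rw [TestFunction.integralAgainstBilinCLM_eq_integral hf]
  simp

/-- The `i`-th partial derivative of a distribution on `Ω`. -/
def partialDeriv {Ω : Opens (EuclideanSpace ℝ (Fin n))} (i : Fin n) (T : 𝓓'(Ω, ℝ)) : 𝓓'(Ω, ℝ) :=
  ∂_{EuclideanSpace.single i (1 : ℝ)} T

/-- `g_ν → G` in `C^{-1,α}_loc(Ω)`, for functions `g_ν` that are smooth on `Ω` and a distribution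
`G` on `Ω`. For every open `V ⋐ Ω`, on `V` one has `g_ν - G = a_ν + div A_ν` in the sense of
distributions, where the scalar functions `a_ν` and the vector fields `A_ν` tend to `0` in
`C^{0,α}(V)`. -/
def TendstoNegHolderLoc (Ω : Opens (EuclideanSpace ℝ (Fin n))) (α : ℝ)
    (g : ℕ → EuclideanSpace ℝ (Fin n) → ℝ) (G : 𝓓'(Ω, ℝ)) : Prop :=
  ∀ V : Opens (EuclideanSpace ℝ (Fin n)), CompactlyInside V Ω →
    ∃ (a : ℕ → EuclideanSpace ℝ (Fin n) → ℝ)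
      (A : ℕ → EuclideanSpace ℝ (Fin n) → EuclideanSpace ℝ (Fin n)) (ε : ℕ → ℝ),
      Tendsto ε atTop (𝓝 0) ∧
      (∀ ν, HolderBound (V : Set (EuclideanSpace ℝ (Fin n))) α (a ν) (ε ν)) ∧
      (∀ ν, HolderBound (V : Set (EuclideanSpace ℝ (Fin n))) α (A ν) (ε ν)) ∧
      ∀ ν, ∀ φ : 𝓓(Ω, ℝ), tsupport φ ⊆ V →
        (∫ x, g ν x * φ x) - G φ = (∫ x, a ν x * φ x) - ∫ x, fderiv ℝ φ x (A ν x)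

/-- `T` is the product of the function `f` and the distribution `G` on `Ω`. It is the limit, in the
sense of distributions, of products `f_ν g_ν` of smooth functions, where `f_ν → f` in
`C^{0,α}_loc(Ω)` and `g_ν → G` in `C^{-1,β}_loc(Ω)` for some `α, β ∈ (0, 1)` with `α + β > 1`. -/
def IsProduct (Ω : Opens (EuclideanSpace ℝ (Fin n))) (f : EuclideanSpace ℝ (Fin n) → ℝ)
    (G T : 𝓓'(Ω, ℝ)) : Prop :=
  ∃ α ∈ Ioo (0 : ℝ) 1, ∃ β ∈ Ioo (0 : ℝ) 1, 1 < α + β ∧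
    ∃ F g : ℕ → EuclideanSpace ℝ (Fin n) → ℝ,
      (∀ ν, ContDiffOn ℝ ∞ (F ν) Ω) ∧ (∀ ν, ContDiffOn ℝ ∞ (g ν) Ω) ∧
      TendstoHolderLoc Ω α F f ∧ TendstoNegHolderLoc Ω β g G ∧
      ∀ φ : 𝓓(Ω, ℝ), Tendsto (fun ν ↦ ∫ x, F ν x * g ν x * φ x) atTop (𝓝 (T φ))

/-- `Z = (Z¹, …, Zⁿ)` is the distributional Lie bracket `[X, Y]` on `Ω`:
`Zʲ = ∑ i, (Xⁱ ∂_i Yʲ - Yⁱ ∂_i Xʲ)`, with derivatives and products in the sense of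
distributions. -/
def IsLieBracket (Ω : Opens (EuclideanSpace ℝ (Fin n)))
    (X Y : EuclideanSpace ℝ (Fin n) → EuclideanSpace ℝ (Fin n)) (Z : Fin n → 𝓓'(Ω, ℝ)) : Prop :=
  ∀ j : Fin n, ∃ P Q : Fin n → 𝓓'(Ω, ℝ),
    (∀ i, IsProduct Ω (fun x ↦ X x i) (partialDeriv i (toDistribution Ω fun x ↦ Y x j)) (P i)) ∧
    (∀ i, IsProduct Ω (fun x ↦ Y x i) (partialDeriv i (toDistribution Ω fun x ↦ X x j)) (Q i)) ∧
    Z j = ∑ i, (P i - Q i)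

end Distributions

section Flow

variable {E : Type*} [NormedAddCommGroup E] [NormedSpace ℝ E]

/-- `γ` solves `γ' = X(γ)`, `γ(0) = p`, with values in `Ω`, on the open interval `I ∋ 0`. -/
structure IsSolution (Ω : Opens E) (X : E → E) (p : E) (I : Set ℝ) (γ : ℝ → E) : Prop where
  isOpen : IsOpen I
  ordConnected : I.OrdConnected
  zero_mem : (0 : ℝ) ∈ I
  init : γ 0 = p
  mapsTo : MapsTo γ I Ω
  integralCurve : IsIntegralCurveOn γ (fun _ ↦ X) I

/-- `γ` on `I` is the unique maximal solution in `Ω` starting at `p`: every other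
solution is a restriction of it. -/
structure IsMaximalSolution (Ω : Opens E) (X : E → E) (p : E) (I : Set ℝ) (γ : ℝ → E) : Prop
    extends IsSolution Ω X p I γ where
  maximal : ∀ J δ, IsSolution Ω X p J δ → J ⊆ I ∧ EqOn δ γ J

/-- The flow domain `D_X ⊆ ℝ × Ω`: the pairs `(t, p)` such that the unique maximal solution
starting at `p` exists and is defined at time `t`. -/
def flowDomain (Ω : Opens E) (X : E → E) : Set (ℝ × E) :=
  {q | ∃ I γ, IsMaximalSolution Ω X q.2 I γ ∧ q.1 ∈ I}

open Classical in
/-- The flow map `F_X^t(p)`, for `(t, p)` in the flow domain (with value `0` elsewhere). -/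
def flow (Ω : Opens E) (X : E → E) (t : ℝ) (p : E) : E :=
  if h : ∃ I γ, IsMaximalSolution Ω X p I γ ∧ t ∈ I then h.choose_spec.choose t else 0

lemma flow_eq {Ω : Opens E} {X : E → E} {p : E} {I : Set ℝ} {γ : ℝ → E}
    (h : IsMaximalSolution Ω X p I γ) {t : ℝ} (ht : t ∈ I) : flow Ω X t p = γ t := by
  have hex : ∃ I γ, IsMaximalSolution Ω X p I γ ∧ t ∈ I := ⟨I, γ, h, ht⟩
  rw [flow, dif_pos hex]
  obtain ⟨h₁, h₂⟩ := hex.choose_spec.choose_spec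
  exact (h.maximal _ _ h₁.toIsSolution).2 h₂

end Flow

end LogLipFlow

end

/-!
Commuting flows of log-Lipschitz vector fields whose distributional bracket vanishes.

Let `X_N`, `Y_N` be the mollifications of `X`, `Y` at scale `ε = r e ^ (-N)`. Since the fields are
log-Lipschitz, `X_N` and `Y_N` have Lipschitz constants that grow only linearly, like `C (N + 1)`,
while they are `O(e ^ (-3 N / 4))` close to `X` and `Y`. This is the content of `LogApprox`. By
Grönwall's inequality an error `e ^ (-N / 2)` in the equation costs at most
`t e ^ (C (N + 1) t - N / 2)` in the solution, which tends to zero for small `t`. This gives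
existence, uniqueness and maximal solutions, with flows that are the limits of those of `X_N`, `Y_N`
(`LogApprox.exists_solution`, `LocallyLogApprox.flow_eq`).

The same factor beats the bracket: if `[X_N, Y_N] = O(e ^ (-N / 2))`, then the flows of `X_N` and
`Y_N` commute up to `O(e ^ (-N / 2))` times a Grönwall factor. Indeed, if `u_s` is the integral curve of
`X_N` through the point that the flow of `Y_N` reaches at time `s`, then `u_s + h Y_N(u_s)` solves the
equation of `X_N` up to `h [X_N, Y_N] + O(h ^ 2)`, hence is close to `u_{s + h}`; so `s ↦ u_s(t)` is
almost an integral curve of `Y_N` (`norm_flow_commutator_le`). Letting `N → ∞` gives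
`LogApprox.flow_commute`.

It remains to bound `[X_N, Y_N]`. Products `f ∂ᵢA` of Hölder functions and derivatives of Hölder
functions are defined by Young's theory: the pairing with a test function `φ` is the limit, along
dyadic steps `h`, of the difference quotients of `A` integrated against `f φ`, and consecutive terms
differ by `O(h ^ (α + β - 1))` (`YoungPair`). The estimate is uniform along approximating sequences,
so that every admissible product is this limit (`IsProduct.tendsto_diffPairing`). Applied to
`(f - f x) φ`, with the mollifying kernel centred at `x` as `φ`, it shows that mollifying the product
`f ∂ᵢA` and multiplying `f x` with the mollified derivative differ by `O(ε ^ (1 / 2))`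
(`IsProduct.abs_sub_le`). Testing `[X, Y] = 0` with the kernel therefore bounds the bracket of the
mollified fields (`IsLieBracket.norm_bracket_mollField_le`).
-/

set_option linter.unusedSectionVars false

namespace LogLipFlow

/-! ### Grönwall estimates -/

section ODE

variable {E : Type*} [NormedAddCommGroup E] [NormedSpace ℝ E]

lemma gronwallBound_le {δ K ε x : ℝ} (hK : 0 ≤ K) (hε : 0 ≤ ε) :
    gronwallBound δ K ε x ≤ (δ + ε * x) * Real.exp (K * x) := by
  rcases hK.eq_or_lt with rfl | hK
  · simp [gronwallBound_K0]
  rw [gronwallBound_of_K_ne_0 hK.ne']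
  have h1 : (1 - K * x) * Real.exp (K * x) ≤ 1 := by
    have h := Real.add_one_le_exp (-(K * x))
    calc (1 - K * x) * Real.exp (K * x) ≤ Real.exp (-(K * x)) * Real.exp (K * x) := by
          gcongr; linarith
      _ = 1 := by rw [← Real.exp_add]; simp
  have h2 : ε / K * (Real.exp (K * x) - 1) ≤ ε * x * Real.exp (K * x) := by
    rw [div_mul_eq_mul_div, div_le_iff₀ hK]
    nlinarith [mul_nonneg hε (sub_nonneg.2 h1)]
  simp only
  linarith

/-- Grönwall estimate for two approximate solutions of `z' = Z(z)` with defects `a` and `b`. The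
Lipschitz bound on `Z` is only needed on a set `S` containing both curves. -/
lemma norm_sub_le_of_approx_solutions_right {Z : E → E} {S : Set E} {K a b T : ℝ} (hK : 0 ≤ K)
    (ha : 0 ≤ a) (hb : 0 ≤ b) (hZ : ∀ x ∈ S, ∀ y ∈ S, ‖Z x - Z y‖ ≤ K * ‖x - y‖)
    {x y x' y' : ℝ → E}
    (hx : ∀ t ∈ Icc 0 T, HasDerivAt x (x' t) t) (hxZ : ∀ t ∈ Icc 0 T, ‖x' t - Z (x t)‖ ≤ a)
    (hxS : ∀ t ∈ Icc 0 T, x t ∈ S)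
    (hy : ∀ t ∈ Icc 0 T, HasDerivAt y (y' t) t) (hyZ : ∀ t ∈ Icc 0 T, ‖y' t - Z (y t)‖ ≤ b)
    (hyS : ∀ t ∈ Icc 0 T, y t ∈ S) :
    ∀ t ∈ Icc 0 T, ‖x t - y t‖ ≤ (‖x 0 - y 0‖ + (a + b) * t) * Real.exp (K * t) := by
  intro t ht
  have key := norm_le_gronwallBound_of_norm_deriv_right_le (f := fun t ↦ x t - y t)
    (f' := fun t ↦ x' t - y' t) (δ := ‖x 0 - y 0‖) (K := K) (ε := a + b) (a := 0) (b := T)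
    (fun t ht ↦ ((hx t ht).sub (hy t ht)).continuousAt.continuousWithinAt)
    (fun t ht ↦ ((hx t ⟨ht.1, ht.2.le⟩).sub (hy t ⟨ht.1, ht.2.le⟩)).hasDerivWithinAt) le_rfl
    (by
      intro t ht
      have ht' : t ∈ Icc 0 T := ⟨ht.1, ht.2.le⟩
      have h1 := hxZ t ht'
      have h2 := hyZ t ht'
      have h3 := hZ _ (hxS t ht') _ (hyS t ht')
      calc ‖x' t - y' t‖
          = ‖(x' t - Z (x t)) + (Z (x t) - Z (y t)) - (y' t - Z (y t))‖ := by congr 1; abel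
        _ ≤ ‖x' t - Z (x t)‖ + ‖Z (x t) - Z (y t)‖ + ‖y' t - Z (y t)‖ :=
            (norm_sub_le _ _).trans (by gcongr; exact norm_add_le _ _)
        _ ≤ K * ‖x t - y t‖ + (a + b) := by linarith) t ht
  rw [sub_zero] at key
  exact key.trans (gronwallBound_le hK (add_nonneg ha hb))

lemma hasDerivAt_comp_neg {x : ℝ → E} {x' : E} {t : ℝ} (h : HasDerivAt x x' (-t)) :
    HasDerivAt (fun s ↦ x (-s)) (-x') t := by
  simpa [Function.comp_def] using h.scomp t (hasDerivAt_neg t)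

/-- Two-sided Grönwall estimate for two approximate solutions of `z' = Z(z)` with defects `a`
and `b`. -/
lemma norm_sub_le_of_approx_solutions {Z : E → E} {S : Set E} {K a b τ : ℝ} (hK : 0 ≤ K)
    (ha : 0 ≤ a) (hb : 0 ≤ b) (hZ : ∀ x ∈ S, ∀ y ∈ S, ‖Z x - Z y‖ ≤ K * ‖x - y‖)
    {x y x' y' : ℝ → E}
    (hx : ∀ t ∈ Ioo (-τ) τ, HasDerivAt x (x' t) t)
    (hxZ : ∀ t ∈ Ioo (-τ) τ, ‖x' t - Z (x t)‖ ≤ a) (hxS : ∀ t ∈ Ioo (-τ) τ, x t ∈ S)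
    (hy : ∀ t ∈ Ioo (-τ) τ, HasDerivAt y (y' t) t)
    (hyZ : ∀ t ∈ Ioo (-τ) τ, ‖y' t - Z (y t)‖ ≤ b) (hyS : ∀ t ∈ Ioo (-τ) τ, y t ∈ S) :
    ∀ t ∈ Ioo (-τ) τ, ‖x t - y t‖ ≤ (‖x 0 - y 0‖ + (a + b) * |t|) * Real.exp (K * |t|) := by
  intro t ht
  have hsub : ∀ s ∈ Icc 0 |t|, s ∈ Ioo (-τ) τ ∧ -s ∈ Ioo (-τ) τ := by
    intro s hs
    have := abs_lt.2 ht
    exact ⟨⟨by linarith [hs.1, hs.2], by linarith [hs.2]⟩,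
      ⟨by linarith [hs.2], by linarith [hs.1, hs.2]⟩⟩
  rcases le_total 0 t with h0 | h0
  · have := norm_sub_le_of_approx_solutions_right (T := |t|) hK ha hb hZ
      (fun s hs ↦ hx s (hsub s hs).1) (fun s hs ↦ hxZ s (hsub s hs).1)
      (fun s hs ↦ hxS s (hsub s hs).1) (fun s hs ↦ hy s (hsub s hs).1)
      (fun s hs ↦ hyZ s (hsub s hs).1) (fun s hs ↦ hyS s (hsub s hs).1) |t|
      ⟨abs_nonneg _, le_rfl⟩
    rwa [abs_of_nonneg h0] at this ⊢
  · have := norm_sub_le_of_approx_solutions_right (T := |t|) (Z := fun z ↦ -Z z)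
      (x := fun s ↦ x (-s)) (y := fun s ↦ y (-s)) (x' := fun s ↦ -x' (-s))
      (y' := fun s ↦ -y' (-s)) hK ha hb
      (fun u hu v hv ↦ by
        rw [neg_sub_neg, norm_sub_rev]; exact hZ u hu v hv)
      (fun s hs ↦ hasDerivAt_comp_neg (hx _ (hsub s hs).2))
      (fun s hs ↦ by
        rw [neg_sub_neg, norm_sub_rev]; exact hxZ _ (hsub s hs).2)
      (fun s hs ↦ hxS _ (hsub s hs).2)
      (fun s hs ↦ hasDerivAt_comp_neg (hy _ (hsub s hs).2))
      (fun s hs ↦ by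
        rw [neg_sub_neg, norm_sub_rev]; exact hyZ _ (hsub s hs).2)
      (fun s hs ↦ hyS _ (hsub s hs).2) |t| ⟨abs_nonneg _, le_rfl⟩
    simpa [abs_of_nonpos h0] using this

lemma norm_sub_le_mul_abs_of_hasDerivAt {x x' : ℝ → E} {C τ : ℝ}
    (hx : ∀ t ∈ Ioo (-τ) τ, HasDerivAt x (x' t) t) (hb : ∀ t ∈ Ioo (-τ) τ, ‖x' t‖ ≤ C) :
    ∀ s ∈ Ioo (-τ) τ, ∀ t ∈ Ioo (-τ) τ, ‖x t - x s‖ ≤ C * |t - s| := fun _ hs _ ht ↦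
  (convex_Ioo (-τ) τ).norm_image_sub_le_of_norm_hasDerivWithin_le
    (fun u hu ↦ (hx u hu).hasDerivWithinAt) hb hs ht

end ODE

/-! ### Flows of exponentially well approximated vector fields -/

section Approximation

variable {E : Type*} [NormedAddCommGroup E]

/-- The vector field `X` is approximated on `S` by the fields `Z N`, whose Lipschitz constants on
`S` grow at most linearly in `N` while the error decays like `exp (-N / 2)`. Over a time `t` with
`C t < 1 / 2` the Grönwall factor `exp (C (N + 1) t)` does not destroy the convergence. -/
structure LogApprox (X : E → E) (S : Set E) (C : ℝ) (Z : ℕ → E → E) : Prop where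
  nonneg : 0 ≤ C
  bound : ∀ N x, ‖Z N x‖ ≤ C
  lip : ∀ N, ∀ x ∈ S, ∀ y ∈ S, ‖Z N x - Z N y‖ ≤ C * (N + 1) * ‖x - y‖
  close : ∀ N, ∀ x ∈ S, ‖Z N x - X x‖ ≤ C * Real.exp (-(N / 2))

lemma LogApprox.mono {X : E → E} {S S' : Set E} {C : ℝ} {Z : ℕ → E → E} (h : LogApprox X S C Z)
    (hS : S' ⊆ S) : LogApprox X S' C Z where
  nonneg := h.nonneg
  bound := h.bound
  lip N x hx y hy := h.lip N x (hS hx) y (hS hy)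
  close N x hx := h.close N x (hS hx)

end Approximation

lemma tendsto_mul_exp_mul_exp {A b c : ℝ} (h : b < c) :
    Tendsto (fun N : ℕ ↦ A * Real.exp (-(N * c)) * Real.exp (b * (N + 1))) atTop (𝓝 0) := by
  have h1 : Tendsto (fun N : ℕ ↦ A * Real.exp b * Real.exp (-(c - b)) ^ N) atTop (𝓝 0) := by
    rw [← mul_zero (A * Real.exp b)]
    exact (tendsto_pow_atTop_nhds_zero_of_lt_one (Real.exp_pos _).le
      (Real.exp_lt_one_iff.2 (by linarith))).const_mul _
  refine h1.congr fun N ↦ ?_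
  rw [← Real.exp_nat_mul, mul_assoc, mul_assoc, ← Real.exp_add, ← Real.exp_add]
  ring_nf

lemma tendsto_mul_exp {A c : ℝ} (h : 0 < c) :
    Tendsto (fun N : ℕ ↦ A * Real.exp (-(N * c))) atTop (𝓝 0) := by
  simpa using tendsto_mul_exp_mul_exp (A := A) h

section ODE

variable {E : Type*} [NormedAddCommGroup E] [NormedSpace ℝ E]

/-- Solutions of a `LogApprox` field are unique for short times. -/
lemma LogApprox.eqOn {X : E → E} {S : Set E} {C : ℝ} {Z : ℕ → E → E} (h : LogApprox X S C Z)
    {τ : ℝ} (hτ : C * τ < 1 / 2) {x y : ℝ → E} (h0 : x 0 = y 0)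
    (hx : ∀ t ∈ Ioo (-τ) τ, HasDerivAt x (X (x t)) t) (hxS : ∀ t ∈ Ioo (-τ) τ, x t ∈ S)
    (hy : ∀ t ∈ Ioo (-τ) τ, HasDerivAt y (X (y t)) t) (hyS : ∀ t ∈ Ioo (-τ) τ, y t ∈ S) :
    EqOn x y (Ioo (-τ) τ) := by
  intro t ht
  have hC := h.nonneg
  have key : ∀ N : ℕ, ‖x t - y t‖ ≤
      (2 * C * τ) * Real.exp (-(N * (1 / 2))) * Real.exp (C * τ * (N + 1)) := by
    intro N
    have := norm_sub_le_of_approx_solutions (Z := Z N) (K := C * (N + 1))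
      (a := C * Real.exp (-(N / 2))) (b := C * Real.exp (-(N / 2))) (by positivity)
      (by positivity) (by positivity) (h.lip N) hx
      (fun s hs ↦ by rw [norm_sub_rev]; exact h.close N _ (hxS s hs)) hxS hy
      (fun s hs ↦ by rw [norm_sub_rev]; exact h.close N _ (hyS s hs)) hyS t ht
    rw [h0, sub_self, norm_zero, zero_add] at this
    have htτ : |t| ≤ τ := (abs_lt.2 ht).le
    have hτ0 : 0 ≤ τ := (abs_nonneg t).trans htτ
    calc _ ≤ _ := this
      _ ≤ ((C * Real.exp (-(N / 2)) + C * Real.exp (-(N / 2))) * τ) *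
          Real.exp (C * (N + 1) * τ) := by gcongr
      _ = _ := by
        rw [show C * (N + 1) * τ = C * τ * (N + 1) by ring,
          show (N : ℝ) / 2 = N * (1 / 2) by ring]
        ring
  have h3 : ‖x t - y t‖ ≤ 0 := ge_of_tendsto' (tendsto_mul_exp_mul_exp hτ) key
  exact sub_eq_zero.1 (norm_le_zero_iff.1 h3)

lemma exists_solution_of_lipschitz [CompleteSpace E] {Z : E → E} {q : E} {R C K τ : ℝ}
    (hR : 0 ≤ R) (hτ : 0 < τ)
    (hC : 0 ≤ C) (hK : 0 ≤ K) (hCτ : C * τ ≤ R) (hb : ∀ x, ‖Z x‖ ≤ C)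
    (hZ : ∀ x ∈ Metric.closedBall q R, ∀ y ∈ Metric.closedBall q R, ‖Z x - Z y‖ ≤ K * ‖x - y‖) :
    ∃ x : ℝ → E, x 0 = q ∧ (∀ t ∈ Ioo (-τ) τ, HasDerivAt x (Z (x t)) t) ∧
      ∀ t ∈ Ioo (-τ) τ, x t ∈ Metric.closedBall q R := by
  have hpl : IsPicardLindelof (fun _ ↦ Z) (tmin := -τ) (tmax := τ) ⟨0, by simp [hτ.le]⟩ q
      ⟨R, hR⟩ 0 ⟨C, hC⟩ ⟨K, hK⟩ := by
    refine IsPicardLindelof.of_time_independent (fun x _ ↦ hb x) ?_ ?_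
    · exact LipschitzOnWith.of_dist_le_mul fun x hx y hy ↦ by
        rw [dist_eq_norm, dist_eq_norm]; exact hZ x hx y hy
    · simpa using! hCτ
  obtain ⟨x, hx0, hx⟩ := hpl.exists_eq_forall_mem_Icc_hasDerivWithinAt₀
  have hd : ∀ t ∈ Ioo (-τ) τ, HasDerivAt x (Z (x t)) t := fun t ht ↦
    (hx t (Ioo_subset_Icc_self ht)).hasDerivAt (Icc_mem_nhds ht.1 ht.2)
  refine ⟨x, hx0, hd, fun t ht ↦ ?_⟩
  have h1 := norm_sub_le_mul_abs_of_hasDerivAt hd (fun _ _ ↦ hb _) 0 ⟨by linarith, hτ⟩ t ht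
  rw [mem_closedBall_iff_norm]
  simp only [hx0, sub_zero] at h1
  exact h1.trans (le_trans (by gcongr; exact (abs_lt.2 ht).le) hCτ)

/-- Short-time existence for a `LogApprox` field: the solutions of the approximating fields form a
Cauchy sequence, with limit a solution. -/
lemma LogApprox.exists_solution [CompleteSpace E] {X : E → E} {q : E} {R C τ : ℝ} {Z : ℕ → E → E}
    (h : LogApprox X (Metric.closedBall q R) C Z) (hR : 0 ≤ R) (hτ : 0 < τ) (hCτ : C * τ ≤ R)
    (hCτ' : C * τ ≤ 1 / 8) :
    ∃ x : ℝ → E, x 0 = q ∧ (∀ t ∈ Ioo (-τ) τ, HasDerivAt x (X (x t)) t) ∧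
      ∀ t ∈ Ioo (-τ) τ, x t ∈ Metric.closedBall q R := by
  have hC := h.nonneg
  have hex := fun N : ℕ ↦ exists_solution_of_lipschitz (K := C * (N + 1)) hR hτ hC
    (by positivity) hCτ (h.bound N) (h.lip N)
  choose x hx0 hx hxS using hex
  -- decay `exp (-N / 2)` against the Grönwall factor `exp ((N + 1) / 8)` leaves `exp (-3 N / 8)`
  set A : ℝ := 2 * C * τ * Real.exp (1 / 8) with hA
  have hA0 : 0 ≤ A := by positivity
  have key : ∀ N M : ℕ, N ≤ M → ∀ t ∈ Ioo (-τ) τ,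
      ‖x N t - x M t‖ ≤ A * Real.exp (-(N * (3 / 8))) := by
    intro N M hNM t ht
    have := norm_sub_le_of_approx_solutions (Z := Z N) (K := C * (N + 1))
      (a := 0) (b := 2 * (C * Real.exp (-(N / 2)))) (by positivity)
      le_rfl (by positivity) (h.lip N) (hx N) (fun s hs ↦ by simp) (hxS N) (hx M)
      (fun s hs ↦ by
        have h1 := h.close N _ (hxS M s hs)
        have h2 := h.close M _ (hxS M s hs)
        have h3 : C * Real.exp (-(M / 2)) ≤ C * Real.exp (-(N / 2)) := by gcongr
        calc ‖Z M (x M s) - Z N (x M s)‖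
            = ‖(Z M (x M s) - X (x M s)) - (Z N (x M s) - X (x M s))‖ := by congr 1; abel
          _ ≤ _ := (norm_sub_le _ _).trans (by linarith)) (hxS M) t ht
    rw [hx0, hx0, sub_self, norm_zero, zero_add, zero_add] at this
    have htτ : |t| ≤ τ := (abs_lt.2 ht).le
    have hτ0 : 0 ≤ τ := (abs_nonneg t).trans htτ
    calc _ ≤ _ := this
      _ ≤ (2 * (C * Real.exp (-(N / 2))) * τ) * Real.exp (C * (N + 1) * τ) := by gcongr
      _ ≤ (2 * (C * Real.exp (-(N / 2))) * τ) * Real.exp (1 / 8 * (N + 1)) := by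
        have : C * (N + 1) * τ ≤ 1 / 8 * (N + 1) := by
          nlinarith [(Nat.cast_nonneg N : (0 : ℝ) ≤ N)]
        gcongr
      _ = A * Real.exp (-(N * (3 / 8))) := by
        have : Real.exp (-(N / 2)) * Real.exp (1 / 8 * (N + 1)) =
            Real.exp (1 / 8) * Real.exp (-(N * (3 / 8))) := by
          rw [← Real.exp_add, ← Real.exp_add]; ring_nf
        rw [hA]
        linear_combination 2 * C * τ * this
  have hlim : ∀ t ∈ Ioo (-τ) τ, ∃ z, Tendsto (fun N ↦ x N t) atTop (𝓝 z) := by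
    intro t ht
    refine cauchySeq_tendsto_of_complete (cauchySeq_of_le_tendsto_0
      (fun N : ℕ ↦ A * Real.exp (-(N * (3 / 8))) + A * Real.exp (-(N * (3 / 8)))) ?_ ?_)
    · intro n m N hn hm
      rw [dist_eq_norm]
      calc ‖x n t - x m t‖ = ‖(x N t - x m t) - (x N t - x n t)‖ := by congr 1; abel
        _ ≤ _ := (norm_sub_le _ _).trans (add_le_add (key N m hm t ht) (key N n hn t ht))
    · simpa using (tendsto_mul_exp (A := A) (c := 3 / 8) (by norm_num)).add
        (tendsto_mul_exp (A := A) (c := 3 / 8) (by norm_num))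
  choose! y hy using hlim
  have hyN : ∀ N : ℕ, ∀ t ∈ Ioo (-τ) τ, ‖x N t - y t‖ ≤ A * Real.exp (-(N * (3 / 8))) :=
    fun N t ht ↦ le_of_tendsto ((tendsto_const_nhds.sub (hy t ht)).norm)
      ((eventually_ge_atTop N).mono fun M hM ↦ key N M hM t ht)
  have h0 : (0 : ℝ) ∈ Ioo (-τ) τ := ⟨by linarith, hτ⟩
  have hyS : ∀ t ∈ Ioo (-τ) τ, y t ∈ Metric.closedBall q R := fun t ht ↦
    Metric.isClosed_closedBall.mem_of_tendsto (hy t ht) (Eventually.of_forall fun N ↦ hxS N t ht)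
  refine ⟨y, ?_, ?_, hyS⟩
  · exact tendsto_nhds_unique (hy 0 h0) (by simp [hx0])
  · intro t ht
    refine hasDerivAt_of_tendstoUniformlyOn (l := atTop) (f := x) (f' := fun N t ↦ Z N (x N t))
      (g' := fun t ↦ X (y t)) isOpen_Ioo ?_ (Eventually.of_forall hx) hy ht
    rw [Metric.tendstoUniformlyOn_iff]
    intro ε hε
    have hto : Tendsto (fun N : ℕ ↦ C * A * Real.exp (-(N * (3 / 8))) * Real.exp (1 / 8 * (N + 1))
        * 8 + C * Real.exp (-(N * (1 / 2)))) atTop (𝓝 0) := by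
      simpa using ((tendsto_mul_exp_mul_exp (A := C * A) (b := 1 / 8) (c := 3 / 8)
        (by norm_num)).mul_const 8).add (tendsto_mul_exp (A := C) (c := 1 / 2) (by norm_num))
    filter_upwards [hto.eventually (gt_mem_nhds hε)] with N hN s hs
    refine lt_of_le_of_lt ?_ hN
    rw [dist_eq_norm, norm_sub_rev]
    have h1 := h.lip N _ (hxS N s hs) _ (hyS s hs)
    have h2 := h.close N _ (hyS s hs)
    have h3 := hyN N s hs
    have h4 : (N : ℝ) + 1 ≤ 8 * Real.exp (1 / 8 * (N + 1)) := by
      linarith [Real.add_one_le_exp (1 / 8 * ((N : ℝ) + 1))]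
    calc ‖Z N (x N s) - X (y s)‖
        = ‖(Z N (x N s) - Z N (y s)) + (Z N (y s) - X (y s))‖ := by congr 1; abel
      _ ≤ C * (N + 1) * ‖x N s - y s‖ + C * Real.exp (-(N / 2)) :=
          (norm_add_le _ _).trans (add_le_add h1 h2)
      _ ≤ C * (8 * Real.exp (1 / 8 * (N + 1))) * (A * Real.exp (-(N * (3 / 8))))
          + C * Real.exp (-(N / 2)) := by gcongr
      _ = _ := by rw [show (N : ℝ) / 2 = N * (1 / 2) by ring]; ring

end ODE

section MaximalSolutions

variable {E : Type*} [NormedAddCommGroup E] [NormedSpace ℝ E]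

/-! ### Maximal solutions -/

/-- Every point of `Ω` has a closed ball in `Ω` on which `X` is a `LogApprox` field. -/
def LocallyLogApprox (Ω : Opens E) (X : E → E) : Prop :=
  ∀ q ∈ Ω, ∃ R > 0, ∃ C Z, Metric.closedBall q R ⊆ Ω ∧ LogApprox X (Metric.closedBall q R) C Z

lemma IsSolution.hasDerivAt {Ω : Opens E} {X : E → E} {p : E} {I : Set ℝ} {γ : ℝ → E}
    (h : IsSolution Ω X p I γ) {t : ℝ} (ht : t ∈ I) : HasDerivAt γ (X (γ t)) t :=
  (h.integralCurve t ht).hasDerivAt (h.isOpen.mem_nhds ht)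

lemma LocallyLogApprox.eventually_eq {Ω : Opens E} {X : E → E} (h : LocallyLogApprox Ω X)
    {x y : ℝ → E} {t₀ : ℝ} (hx : ∀ᶠ t in 𝓝 t₀, HasDerivAt x (X (x t)) t)
    (hy : ∀ᶠ t in 𝓝 t₀, HasDerivAt y (X (y t)) t) (h0 : x t₀ = y t₀) (hΩ : x t₀ ∈ Ω) :
    ∀ᶠ t in 𝓝 t₀, x t = y t := by
  obtain ⟨R, hR, C, Z, -, hZ⟩ := h _ hΩ
  have hxB : ∀ᶠ t in 𝓝 t₀, x t ∈ Metric.closedBall (x t₀) R :=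
    hx.self_of_nhds.continuousAt (Metric.closedBall_mem_nhds _ hR)
  have hyB : ∀ᶠ t in 𝓝 t₀, y t ∈ Metric.closedBall (x t₀) R := by
    rw [h0]
    exact hy.self_of_nhds.continuousAt (Metric.closedBall_mem_nhds _ hR)
  obtain ⟨δ, hδ, hball⟩ := Metric.eventually_nhds_iff.1 (((hx.and hy).and hxB).and hyB)
  obtain ⟨τ, hτ, hτδ, hτC⟩ : ∃ τ > 0, τ ≤ δ ∧ C * τ < 1 / 2 := by
    have hC := hZ.nonneg
    refine ⟨min δ (1 / (4 * (C + 1))), by positivity, min_le_left _ _, ?_⟩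
    calc C * min δ (1 / (4 * (C + 1))) ≤ (C + 1) * (1 / (4 * (C + 1))) := by
          gcongr
          · linarith
          · exact min_le_right _ _
      _ < 1 / 2 := by field_simp; norm_num
  have hmem : ∀ t ∈ Ioo (-τ) τ, dist (t + t₀) t₀ < δ := fun t ht ↦ by
    simpa using (abs_lt.2 ht).trans_le hτδ
  have heq := hZ.eqOn hτC (x := fun t ↦ x (t + t₀)) (y := fun t ↦ y (t + t₀)) (by simpa using h0)
    (fun t ht ↦ (hball (hmem t ht)).1.1.1.comp_add_const t t₀)
    (fun t ht ↦ (hball (hmem t ht)).1.2)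
    (fun t ht ↦ (hball (hmem t ht)).1.1.2.comp_add_const t t₀)
    (fun t ht ↦ (hball (hmem t ht)).2)
  rw [Metric.eventually_nhds_iff]
  refine ⟨τ, hτ, fun t ht ↦ ?_⟩
  have : t - t₀ ∈ Ioo (-τ) τ := abs_lt.1 (by simpa [Real.dist_eq] using ht)
  simpa using heq this

lemma LocallyLogApprox.eqOn_inter {Ω : Opens E} {X : E → E} (h : LocallyLogApprox Ω X) {p : E}
    {I J : Set ℝ} {x y : ℝ → E} (hx : IsSolution Ω X p I x) (hy : IsSolution Ω X p J y) :
    EqOn x y (I ∩ J) := by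
  have hopen : IsOpen (I ∩ J) := hx.isOpen.inter hy.isOpen
  have hconn : IsPreconnected (I ∩ J) := (hx.ordConnected.inter hy.ordConnected).isPreconnected
  set A : Set ℝ := {t | t ∈ I ∩ J ∧ x t = y t} with hA
  have hAopen : IsOpen A := by
    rw [isOpen_iff_mem_nhds]
    rintro t ⟨ht, hxy⟩
    have hev := h.eventually_eq
      ((hx.isOpen.eventually_mem ht.1).mono fun s hs ↦ hx.hasDerivAt hs)
      ((hy.isOpen.eventually_mem ht.2).mono fun s hs ↦ hy.hasDerivAt hs)
      hxy (hx.mapsTo ht.1)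
    filter_upwards [hev, hopen.mem_nhds ht] with s h1 h2 using ⟨h2, h1⟩
  have hsub : I ∩ J ⊆ A := by
    refine hconn.subset_of_closure_inter_subset hAopen
      ⟨0, ⟨hx.zero_mem, hy.zero_mem⟩, ⟨hx.zero_mem, hy.zero_mem⟩, by rw [hx.init, hy.init]⟩ ?_
    rintro t ⟨htA, ht⟩
    refine ⟨ht, ?_⟩
    have := mem_closure_iff_nhdsWithin_neBot.1 htA
    have h1 : Tendsto x (𝓝[A] t) (𝓝 (x t)) :=
      (hx.hasDerivAt ht.1).continuousAt.continuousWithinAt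
    have h2 : Tendsto y (𝓝[A] t) (𝓝 (y t)) :=
      (hy.hasDerivAt ht.2).continuousAt.continuousWithinAt
    exact tendsto_nhds_unique (h1.congr' (eventually_nhdsWithin_of_forall fun s hs ↦ hs.2)) h2
  exact fun t ht ↦ (hsub ht).2

lemma isSolution_Ioo {Ω : Opens E} {X : E → E} {p : E} {τ : ℝ} (hτ : 0 < τ) {x : ℝ → E}
    (h0 : x 0 = p) (hx : ∀ t ∈ Ioo (-τ) τ, HasDerivAt x (X (x t)) t)
    (hxΩ : ∀ t ∈ Ioo (-τ) τ, x t ∈ Ω) : IsSolution Ω X p (Ioo (-τ) τ) x where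
  isOpen := isOpen_Ioo
  ordConnected := ordConnected_Ioo
  zero_mem := ⟨by linarith, hτ⟩
  init := h0
  mapsTo := hxΩ
  integralCurve t ht := (hx t ht).hasDerivWithinAt

lemma LocallyLogApprox.exists_isSolution [CompleteSpace E] {Ω : Opens E} {X : E → E}
    (h : LocallyLogApprox Ω X) {p : E} (hp : p ∈ Ω) : ∃ I γ, IsSolution Ω X p I γ := by
  obtain ⟨R, hR, C, Z, hRΩ, hZ⟩ := h p hp
  have hC := hZ.nonneg
  have hτ : 0 < min R (1 / 8) / (C + 1) := by positivity
  have hle : C * (min R (1 / 8) / (C + 1)) ≤ min R (1 / 8) := by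
    rw [mul_div_assoc', div_le_iff₀ (by positivity)]
    nlinarith [lt_min hR (by norm_num : (0 : ℝ) < 1 / 8)]
  obtain ⟨x, hx0, hx, hxS⟩ := hZ.exists_solution hR.le hτ (hle.trans (min_le_left _ _))
    (hle.trans (min_le_right _ _))
  exact ⟨_, x, isSolution_Ioo hτ hx0 hx fun t ht ↦ hRΩ (hxS t ht)⟩

lemma LocallyLogApprox.exists_isMaximalSolution [CompleteSpace E] {Ω : Opens E} {X : E → E}
    (h : LocallyLogApprox Ω X) {p : E} (hp : p ∈ Ω) : ∃ I γ, IsMaximalSolution Ω X p I γ := by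
  classical
  set I : Set ℝ := ⋃₀ {J | ∃ δ, IsSolution Ω X p J δ} with hI
  have hmem : ∀ t, t ∈ I → ∃ J δ, IsSolution Ω X p J δ ∧ t ∈ J := by
    rintro t ⟨J, ⟨δ, hδ⟩, ht⟩
    exact ⟨J, δ, hδ, ht⟩
  choose! J δ hδ htJ using hmem
  set γ : ℝ → E := fun t ↦ δ t t with hγ
  have heq : ∀ J' δ', IsSolution Ω X p J' δ' → EqOn δ' γ J' := fun J' δ' h' t ht ↦
    have htI : t ∈ I := ⟨J', ⟨δ', h'⟩, ht⟩
    h.eqOn_inter h' (hδ t htI) ⟨ht, htJ t htI⟩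
  obtain ⟨J₀, δ₀, h₀⟩ := h.exists_isSolution hp
  have hopen : IsOpen I := isOpen_sUnion fun J ⟨_, h⟩ ↦ h.isOpen
  refine ⟨I, γ, ⟨hopen, ?_, ⟨J₀, ⟨δ₀, h₀⟩, h₀.zero_mem⟩, ?_, ?_, ?_⟩, ?_⟩
  · exact (isPreconnected_sUnion 0 {J | ∃ δ, IsSolution Ω X p J δ} (fun J ⟨_, h⟩ ↦ h.zero_mem)
      fun J ⟨_, h⟩ ↦ h.ordConnected.isPreconnected).ordConnected
  · rw [← heq _ _ h₀ h₀.zero_mem, h₀.init]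
  · exact fun t ht ↦ (hδ t ht).mapsTo (htJ t ht)
  · intro t ht
    have hd := (hδ t ht).hasDerivAt (htJ t ht)
    have hev : δ t =ᶠ[𝓝 t] γ :=
      ((hδ t ht).isOpen.eventually_mem (htJ t ht)).mono fun s hs ↦
        heq _ _ (hδ t ht) hs
    exact (hd.congr_of_eventuallyEq hev.symm).hasDerivWithinAt
  · exact fun J' δ' h' ↦ ⟨fun t ht ↦ ⟨J', ⟨δ', h'⟩, ht⟩, heq J' δ' h'⟩

lemma LocallyLogApprox.flow_eq [CompleteSpace E] {Ω : Opens E} {X : E → E}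
    (h : LocallyLogApprox Ω X) {p : E} {I : Set ℝ} {x : ℝ → E} (hx : IsSolution Ω X p I x) {t : ℝ}
    (ht : t ∈ I) : (t, p) ∈ flowDomain Ω X ∧ flow Ω X t p = x t := by
  have hp : p ∈ Ω := by
    have := hx.mapsTo hx.zero_mem
    rwa [hx.init] at this
  obtain ⟨J, γ, hγ⟩ := h.exists_isMaximalSolution hp
  obtain ⟨h1, h2⟩ := hγ.maximal I x hx
  exact ⟨⟨J, γ, hγ, h1 ht⟩, (LogLipFlow.flow_eq hγ (h1 ht)).trans (h2 ht).symm⟩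

end MaximalSolutions

section Commutator

variable {E : Type*} [NormedAddCommGroup E] [NormedSpace ℝ E]

/-! ### Commutators of smooth flows -/

lemma exists_norm_fderiv_sub_le [FiniteDimensional ℝ E] {X : E → E} (hX : ContDiff ℝ 2 X) (p : E)
    (R : ℝ) : ∃ L, 0 ≤ L ∧ ∀ x ∈ Metric.closedBall p R, ∀ y ∈ Metric.closedBall p R,
      ‖fderiv ℝ X y - fderiv ℝ X x‖ ≤ L * ‖y - x‖ := by
  have := FiniteDimensional.proper_real E
  have h1 : ContDiff ℝ 1 (fderiv ℝ X) := hX.fderiv_right (by norm_num)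
  obtain ⟨L, hL⟩ := (isCompact_closedBall p R).exists_bound_of_continuousOn
    (h1.continuous_fderiv (by norm_num)).continuousOn
  refine ⟨max L 0, le_max_right _ _, fun x hx y hy ↦ ?_⟩
  exact (convex_closedBall p R).norm_image_sub_le_of_norm_fderiv_le
    (fun z _ ↦ h1.differentiable (by norm_num) z)
    (fun z hz ↦ (hL z hz).trans (le_max_left _ _)) hx hy

/-- A quantitative form of "vector fields with small bracket have almost commuting flows". Here
`u σ` is the integral curve of `X` through `γ σ`, with `γ` and `v` integral curves of `Y`.
Comparing `u (σ + h)` with the approximate integral curve `u σ + h • Y (u σ)` of `X`, whose defect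
is `h • [X, Y]` up to `O(h ^ 2)`, shows that `σ ↦ u σ t` is an approximate integral curve of
`Y`. -/
lemma norm_flow_commutator_le [FiniteDimensional ℝ E] {X Y : E → E} (hX : ContDiff ℝ 2 X)
    (hY : Differentiable ℝ Y) {p : E} {R K β M s t : ℝ} (hR : 0 < R) (hK : 0 ≤ K) (hβ : 0 ≤ β)
    (hXlip : ∀ x ∈ Metric.closedBall p (2 * R), ∀ y ∈ Metric.closedBall p (2 * R),
      ‖X x - X y‖ ≤ K * ‖x - y‖)
    (hYlip : ∀ x ∈ Metric.closedBall p (2 * R), ∀ y ∈ Metric.closedBall p (2 * R),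
      ‖Y x - Y y‖ ≤ K * ‖x - y‖)
    (hYM : ∀ x, ‖Y x‖ ≤ M)
    (hbr : ∀ x ∈ Metric.closedBall p R, ‖fderiv ℝ Y x (X x) - fderiv ℝ X x (Y x)‖ ≤ β)
    (hs : 0 ≤ s) (ht : 0 ≤ t) {γ v : ℝ → E} {u : ℝ → ℝ → E}
    (hγ : ∀ σ ∈ Icc 0 s, HasDerivAt γ (Y (γ σ)) σ) (hu0 : ∀ σ ∈ Icc 0 s, u σ 0 = γ σ)
    (hu : ∀ σ ∈ Icc 0 s, ∀ θ ∈ Icc 0 t, HasDerivAt (u σ) (X (u σ θ)) θ)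
    (huS : ∀ σ ∈ Icc 0 s, ∀ θ ∈ Icc 0 t, u σ θ ∈ Metric.closedBall p R)
    (hv : ∀ σ ∈ Icc 0 s, HasDerivAt v (Y (v σ)) σ)
    (hvS : ∀ σ ∈ Icc 0 s, v σ ∈ Metric.closedBall p R) (hv0 : v 0 = u 0 t) :
    ‖u s t - v s‖ ≤ s * t * β * Real.exp (K * (s + t)) := by
  obtain ⟨L, hL0, hL⟩ := exists_norm_fderiv_sub_le hX p (2 * R)
  have hM0 : 0 ≤ M := (norm_nonneg _).trans (hYM p)
  have hBB : Metric.closedBall p R ⊆ Metric.closedBall p (2 * R) :=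
    Metric.closedBall_subset_closedBall (by linarith)
  have hball : ∀ x ∈ Metric.closedBall p R, ∀ r ≤ R,
      Metric.closedBall x r ⊆ Metric.closedBall p (2 * R) := fun x hx r hr ↦
    Metric.closedBall_subset_closedBall' (by linarith [Metric.mem_closedBall.1 hx])
  have hrem : ∀ x ∈ Metric.closedBall p R, ∀ w : E, ‖w‖ ≤ R →
      ‖X (x + w) - X x - fderiv ℝ X x w‖ ≤ L * ‖w‖ * ‖w‖ := by
    intro x hx w hw
    have := (convex_closedBall x ‖w‖).norm_image_sub_le_of_norm_fderiv_le' (f := X)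
      (φ := fderiv ℝ X x) (C := L * ‖w‖) (x := x) (y := x + w)
      (fun z _ ↦ hX.differentiable (by norm_num) z)
      (fun z hz ↦ (hL x (hBB hx) z (hball x hx _ hw hz)).trans
        (by gcongr; exact mem_closedBall_iff_norm.1 hz))
      (Metric.mem_closedBall_self (norm_nonneg _)) (by simp)
    simpa using this
  have htt : t ∈ Icc 0 t := ⟨ht, le_rfl⟩
  -- Lipschitz dependence of `u σ t` on `γ σ`
  have hcont : ∀ σ ∈ Icc 0 s, ∀ σ' ∈ Icc 0 s,
      ‖u σ' t - u σ t‖ ≤ ‖γ σ' - γ σ‖ * Real.exp (K * t) := by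
    intro σ hσ σ' hσ'
    have := norm_sub_le_of_approx_solutions_right (Z := X) (S := Metric.closedBall p (2 * R))
      hK le_rfl le_rfl hXlip (hu σ' hσ') (fun θ hθ ↦ by simp)
      (fun θ hθ ↦ hBB (huS σ' hσ' θ hθ)) (hu σ hσ) (fun θ hθ ↦ by simp)
      (fun θ hθ ↦ hBB (huS σ hσ θ hθ)) t htt
    simpa [hu0 σ hσ, hu0 σ' hσ'] using this
  -- `u (σ + h)` against `u σ + h • Y (u σ)`, which solves the equation of `X` up to `h • [X, Y]`
  have hstep : ∀ σ ∈ Icc 0 s, ∀ h : ℝ, 0 ≤ h → h * M ≤ R → σ + h ∈ Icc 0 s →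
      ‖u (σ + h) t - (u σ t + h • Y (u σ t))‖ ≤
        (‖γ (σ + h) - (γ σ + h • Y (γ σ))‖ + (h * β + L * (h * M) * (h * M)) * t) *
          Real.exp (K * t) := by
    intro σ hσ h h0 hhM hσh
    have hw : ∀ x, ‖h • Y x‖ ≤ h * M := fun x ↦ by
      rw [norm_smul, Real.norm_of_nonneg h0]; gcongr; exact hYM x
    have := norm_sub_le_of_approx_solutions_right (Z := X) (S := Metric.closedBall p (2 * R))
      (x := u (σ + h)) (y := fun θ ↦ u σ θ + h • Y (u σ θ)) (a := 0)
      (b := h * β + L * (h * M) * (h * M)) (T := t)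
      (y' := fun θ ↦ X (u σ θ) + h • fderiv ℝ Y (u σ θ) (X (u σ θ)))
      hK le_rfl (by positivity) hXlip (hu _ hσh) (fun θ hθ ↦ by simp)
      (fun θ hθ ↦ hBB (huS _ hσh θ hθ))
      (fun θ hθ ↦ (hu σ hσ θ hθ).add
        (((hY _).hasFDerivAt.comp_hasDerivAt θ (hu σ hσ θ hθ)).const_smul h))
      (fun θ hθ ↦ by
        have hx := huS σ hσ θ hθ
        set x := u σ θ
        have h1 := hrem x hx (h • Y x) ((hw x).trans hhM)
        have h2 := hbr x hx
        rw [map_smul] at h1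
        calc ‖X x + h • fderiv ℝ Y x (X x) - X (x + h • Y x)‖
            = ‖h • (fderiv ℝ Y x (X x) - fderiv ℝ X x (Y x)) -
                (X (x + h • Y x) - X x - h • fderiv ℝ X x (Y x))‖ := by
              congr 1; rw [smul_sub]; abel
          _ ≤ h * β + L * ‖h • Y x‖ * ‖h • Y x‖ := by
              refine (norm_sub_le _ _).trans (add_le_add ?_ h1)
              rw [norm_smul, Real.norm_of_nonneg h0]
              gcongr
          _ ≤ _ := by gcongr <;> exact hw x)
      (fun θ hθ ↦ hball _ (huS σ hσ θ hθ) _ hhM (by simpa using hw (u σ θ))) t htt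
    simpa [hu0 σ hσ, hu0 _ hσh] using this
  set f : ℝ → ℝ := fun σ ↦ ‖u σ t - v σ‖ with hf
  have hfc : ContinuousOn f (Icc 0 s) := by
    refine ContinuousOn.norm (ContinuousOn.sub ?_
      fun σ hσ ↦ (hv σ hσ).continuousAt.continuousWithinAt)
    intro σ hσ
    rw [ContinuousWithinAt, tendsto_iff_norm_sub_tendsto_zero]
    refine squeeze_zero' (Eventually.of_forall fun _ ↦ norm_nonneg _)
      (eventually_nhdsWithin_of_forall fun σ' hσ' ↦ hcont σ hσ σ' hσ') ?_
    have : Tendsto γ (𝓝[Icc 0 s] σ) (𝓝 (γ σ)) := (hγ σ hσ).continuousAt.continuousWithinAt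
    simpa using (tendsto_iff_norm_sub_tendsto_zero.1 this).mul_const (Real.exp (K * t))
  -- the one-step estimate bounds the upper right derivative of `f`
  have hslope : ∀ σ ∈ Ico 0 s, ∀ r, K * f σ + t * β * Real.exp (K * t) < r →
      ∃ᶠ z in 𝓝[>] σ, (z - σ)⁻¹ * (f z - f σ) < r := by
    intro σ hσ r hr
    have hσ' : σ ∈ Icc 0 s := ⟨hσ.1, hσ.2.le⟩
    set G : ℝ → ℝ := fun z ↦ (‖slope γ σ z - Y (γ σ)‖ + (β + L * M * M * (z - σ)) * t) *
      Real.exp (K * t) + K * f σ + ‖slope v σ z - Y (v σ)‖ with hG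
    have hle : 𝓝[>] σ ≤ 𝓝[≠] σ := nhdsWithin_mono _ fun z hz ↦ ne_of_gt hz
    have hGlim : Tendsto G (𝓝[>] σ) (𝓝 (K * f σ + t * β * Real.exp (K * t))) := by
      have h1 := tendsto_iff_norm_sub_tendsto_zero.1
        ((hasDerivAt_iff_tendsto_slope.1 (hγ σ hσ')).mono_left hle)
      have h2 := tendsto_iff_norm_sub_tendsto_zero.1
        ((hasDerivAt_iff_tendsto_slope.1 (hv σ hσ')).mono_left hle)
      have h3 : Tendsto (fun z ↦ (β + L * M * M * (z - σ)) * t) (𝓝[>] σ) (𝓝 (β * t)) := by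
        have : Continuous fun z ↦ (β + L * M * M * (z - σ)) * t := by fun_prop
        have := (this.tendsto σ).mono_left (nhdsWithin_le_nhds (s := Ioi σ))
        simpa using this
      have := (((h1.add h3).mul_const (Real.exp (K * t))).add_const (K * f σ)).add h2
      convert this using 2
      ring
    have hsmall : ∀ᶠ z in 𝓝[>] σ, z < s ∧ (z - σ) * M < R := by
      have h1 : ∀ᶠ z in 𝓝 σ, z < s := Iio_mem_nhds hσ.2
      have h2 : ∀ᶠ z in 𝓝 σ, (z - σ) * M < R := by
        have : Continuous fun z ↦ (z - σ) * M := by fun_prop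
        exact this.tendsto σ (Iio_mem_nhds (by simpa using hR))
      exact nhdsWithin_le_nhds (h1.and h2)
    refine Eventually.frequently ?_
    filter_upwards [hGlim.eventually (gt_mem_nhds hr), hsmall, self_mem_nhdsWithin]
      with z hz ⟨hzs, hzR⟩ hzσ
    refine lt_of_le_of_lt ?_ hz
    obtain ⟨h, rfl⟩ : ∃ h, z = σ + h := ⟨z - σ, by ring⟩
    have h0 : 0 < h := by simpa using hzσ
    have hst := hstep σ hσ' h h0.le (by simpa using hzR.le)
      ⟨by linarith [hσ.1], hzs.le⟩
    have hsl : ∀ (c : ℝ → E) (w : E), ‖c (σ + h) - (c σ + h • w)‖ =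
        h * ‖slope c σ (σ + h) - w‖ := by
      intro c w
      rw [slope_def_module, add_sub_cancel_left, ← Real.norm_of_nonneg h0.le, ← norm_smul,
        smul_sub, smul_smul, Real.norm_of_nonneg h0.le, mul_inv_cancel₀ h0.ne', one_smul]
      congr 1; abel
    have hlip := hYlip _ (hBB (huS σ hσ' t htt)) _ (hBB (hvS σ hσ'))
    have h3 := hsl v (Y (v σ))
    rw [hsl γ] at hst
    have hfz : f (σ + h) ≤ h * G (σ + h) + f σ := by
      calc f (σ + h) = ‖(u (σ + h) t - (u σ t + h • Y (u σ t))) + (u σ t - v σ) +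
            h • (Y (u σ t) - Y (v σ)) - (v (σ + h) - (v σ + h • Y (v σ)))‖ := by
              rw [hf]; simp only; congr 1; rw [smul_sub]; abel
        _ ≤ ‖u (σ + h) t - (u σ t + h • Y (u σ t))‖ + ‖u σ t - v σ‖ +
            ‖h • (Y (u σ t) - Y (v σ))‖ + ‖v (σ + h) - (v σ + h • Y (v σ))‖ :=
              (norm_sub_le _ _).trans (by gcongr; exact norm_add₃_le)
        _ ≤ (h * ‖slope γ σ (σ + h) - Y (γ σ)‖ + (h * β + L * (h * M) * (h * M)) * t) *
              Real.exp (K * t) + f σ + h * (K * f σ) + h * ‖slope v σ (σ + h) - Y (v σ)‖ := by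
              rw [h3, norm_smul, Real.norm_of_nonneg h0.le]
              gcongr
        _ = h * G (σ + h) + f σ := by
              rw [hG]; simp only [add_sub_cancel_left]; ring
    rw [add_sub_cancel_left, inv_mul_le_iff₀ h0]
    linarith
  have hss : s ∈ Icc 0 s := ⟨hs, le_rfl⟩
  have := le_gronwallBound_of_liminf_deriv_right_le (f' := fun σ ↦ K * f σ + t * β *
    Real.exp (K * t)) (δ := 0) (K := K) (ε := t * β * Real.exp (K * t)) hfc hslope
    (by simp [hf, hv0]) (fun _ _ ↦ le_rfl) s hss
  rw [sub_zero] at this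
  refine this.trans ((gronwallBound_le hK (by positivity)).trans (le_of_eq ?_))
  rw [mul_add K, Real.exp_add]
  ring

end Commutator

section Commutation

variable {E : Type*} [NormedAddCommGroup E] [NormedSpace ℝ E]

lemma hasDerivAt_comp_mul_left {x : ℝ → E} {x' : E} {a t : ℝ} (h : HasDerivAt x x' (a * t)) :
    HasDerivAt (fun s ↦ x (a * s)) (a • x') t := by
  simpa [Function.comp_def] using h.scomp t ((hasDerivAt_id t).const_mul a)

/-- The commutator estimate `norm_flow_commutator_le` for times of arbitrary sign. -/
lemma norm_flow_commutator_le_abs [FiniteDimensional ℝ E] {X Y : E → E} (hX : ContDiff ℝ 2 X)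
    (hY : Differentiable ℝ Y) {p : E} {R K β M τ : ℝ} (hR : 0 < R) (hK : 0 ≤ K) (hβ : 0 ≤ β)
    (hXlip : ∀ x ∈ Metric.closedBall p (2 * R), ∀ y ∈ Metric.closedBall p (2 * R),
      ‖X x - X y‖ ≤ K * ‖x - y‖)
    (hYlip : ∀ x ∈ Metric.closedBall p (2 * R), ∀ y ∈ Metric.closedBall p (2 * R),
      ‖Y x - Y y‖ ≤ K * ‖x - y‖)
    (hYM : ∀ x, ‖Y x‖ ≤ M)
    (hbr : ∀ x ∈ Metric.closedBall p R, ‖fderiv ℝ Y x (X x) - fderiv ℝ X x (Y x)‖ ≤ β)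
    {γ : ℝ → E} {u : ℝ → ℝ → E}
    (hγ : ∀ σ ∈ Ioo (-τ) τ, HasDerivAt γ (Y (γ σ)) σ) (hu0 : ∀ σ ∈ Ioo (-τ) τ, u σ 0 = γ σ)
    (hu : ∀ σ ∈ Ioo (-τ) τ, ∀ θ ∈ Ioo (-τ) τ, HasDerivAt (u σ) (X (u σ θ)) θ)
    (huS : ∀ σ ∈ Ioo (-τ) τ, ∀ θ ∈ Ioo (-τ) τ, u σ θ ∈ Metric.closedBall p R)
    {s t : ℝ} (hs : s ∈ Ioo (-τ) τ) (ht : t ∈ Ioo (-τ) τ) {v : ℝ → E}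
    (hv : ∀ σ ∈ Ioo (-τ) τ, HasDerivAt v (Y (v σ)) σ)
    (hvS : ∀ σ ∈ Ioo (-τ) τ, v σ ∈ Metric.closedBall p R) (hv0 : v 0 = u 0 t) :
    ‖u s t - v s‖ ≤ |s| * |t| * β * Real.exp (K * (|s| + |t|)) := by
  have hsign : ∀ r : ℝ, ∃ a : ℝ, |a| = 1 ∧ a * |r| = r := fun r ↦ by
    rcases le_total 0 r with h | h
    · exact ⟨1, by simp, by simp [abs_of_nonneg h]⟩
    · exact ⟨-1, by simp, by simp [abs_of_nonpos h]⟩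
  obtain ⟨a, ha, hat⟩ := hsign t
  obtain ⟨b, hb, hbs⟩ := hsign s
  have hmem : ∀ (c r : ℝ), |c| = 1 → r ∈ Ioo (-τ) τ → ∀ θ ∈ Icc 0 |r|, c * θ ∈ Ioo (-τ) τ := by
    intro c r hc hr θ hθ
    rw [mem_Ioo, ← abs_lt, abs_mul, hc, one_mul, abs_of_nonneg hθ.1]
    exact hθ.2.trans_lt (abs_lt.2 hr)
  have := norm_flow_commutator_le (X := a • X) (Y := b • Y) (p := p) (R := R) (K := K) (β := β)
    (M := M) (s := |s|) (t := |t|) (γ := fun σ ↦ γ (b * σ)) (v := fun σ ↦ v (b * σ))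
    (u := fun σ θ ↦ u (b * σ) (a * θ)) (contDiff_const.smul hX) (hY.const_smul b) hR hK hβ
    (fun x hx y hy ↦ by
      simpa [← smul_sub, norm_smul, ha] using hXlip x hx y hy)
    (fun x hx y hy ↦ by
      simpa [← smul_sub, norm_smul, hb] using hYlip x hx y hy)
    (fun x ↦ by simpa [norm_smul, hb] using hYM x)
    (fun x hx ↦ by
      have h1 : fderiv ℝ (b • Y) x = b • fderiv ℝ Y x := fderiv_const_smul (hY x) b
      have h2 : fderiv ℝ (a • X) x = a • fderiv ℝ X x :=
        fderiv_const_smul (hX.differentiable (by norm_num) x) a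
      rw [h1, h2]
      simp only [Pi.smul_apply, smul_apply, map_smul]
      rw [smul_comm b a, ← smul_sub, ← smul_sub, norm_smul, norm_smul, Real.norm_eq_abs,
        Real.norm_eq_abs, ha, hb, one_mul, one_mul]
      exact hbr x hx)
    (abs_nonneg s) (abs_nonneg t)
    (fun σ hσ ↦ hasDerivAt_comp_mul_left (hγ _ (hmem b s hb hs σ hσ)))
    (fun σ hσ ↦ by simpa using hu0 _ (hmem b s hb hs σ hσ))
    (fun σ hσ θ hθ ↦ hasDerivAt_comp_mul_left
      (hu _ (hmem b s hb hs σ hσ) _ (hmem a t ha ht θ hθ)))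
    (fun σ hσ θ hθ ↦ huS _ (hmem b s hb hs σ hσ) _ (hmem a t ha ht θ hθ))
    (fun σ hσ ↦ hasDerivAt_comp_mul_left (hv _ (hmem b s hb hs σ hσ)))
    (fun σ hσ ↦ hvS _ (hmem b s hb hs σ hσ)) (by simpa [hat] using hv0)
  simpa [hat, hbs] using this

/-! ### Commuting flows in the limit -/

lemma LogApprox.norm_sub_le_of_solutions {X : E → E} {S : Set E} {C : ℝ} {Z : ℕ → E → E}
    (h : LogApprox X S C Z) {τ : ℝ} (hτ : C * τ ≤ 1 / 32) {z x : ℝ → E} (N : ℕ)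
    (hz : ∀ t ∈ Ioo (-τ) τ, HasDerivAt z (Z N (z t)) t) (hzS : ∀ t ∈ Ioo (-τ) τ, z t ∈ S)
    (hx : ∀ t ∈ Ioo (-τ) τ, HasDerivAt x (X (x t)) t) (hxS : ∀ t ∈ Ioo (-τ) τ, x t ∈ S) :
    ∀ t ∈ Ioo (-τ) τ, ‖z t - x t‖ ≤
      (‖z 0 - x 0‖ + C * Real.exp (-(N / 2)) * τ) * Real.exp (1 / 32 * (N + 1)) := by
  intro t ht
  have hC := h.nonneg
  have htτ : |t| ≤ τ := (abs_lt.2 ht).le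
  have hτ0 : 0 ≤ τ := (abs_nonneg t).trans htτ
  have := norm_sub_le_of_approx_solutions (Z := Z N) (K := C * (N + 1)) (a := 0)
    (b := C * Real.exp (-(N / 2))) (by positivity) le_rfl (by positivity) (h.lip N) hz
    (fun s _ ↦ by simp) hzS hx
    (fun s hs ↦ by rw [norm_sub_rev]; exact h.close N _ (hxS s hs)) hxS t ht
  rw [zero_add] at this
  have hexp : C * (N + 1) * |t| ≤ 1 / 32 * (N + 1) := by
    calc C * (N + 1) * |t| ≤ C * (N + 1) * τ := by gcongr
      _ = C * τ * (N + 1) := by ring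
      _ ≤ _ := by gcongr
  exact this.trans (by gcongr)

/-- If `X` and `Y` are approximated by smooth fields with exponentially small brackets, their
flows commute for short times: the estimate `norm_flow_commutator_le` for the approximating fields
survives the limit, since it contains the factor `exp (-N / 2)` against a Grönwall factor
`exp (N / 8)`. -/
theorem LogApprox.flow_commute [FiniteDimensional ℝ E] {Ω : Opens E} {X Y : E → E} {p : E}
    {R C τ : ℝ} {ZX ZY : ℕ → E → E} (hR : 0 < R)
    (hpΩ : Metric.closedBall p (4 * R) ⊆ Ω)
    (hXl : LocallyLogApprox Ω X) (hYl : LocallyLogApprox Ω Y)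
    (hX : LogApprox X (Metric.closedBall p (4 * R)) C ZX)
    (hY : LogApprox Y (Metric.closedBall p (4 * R)) C ZY)
    (hXs : ∀ N, ContDiff ℝ 2 (ZX N)) (hYs : ∀ N, ContDiff ℝ 2 (ZY N))
    (hbr : ∀ N, ∀ x ∈ Metric.closedBall p (4 * R),
      ‖fderiv ℝ (ZY N) x (ZX N x) - fderiv ℝ (ZX N) x (ZY N x)‖ ≤ C * Real.exp (-(N / 2)))
    (hτR : C * τ ≤ R) (hτC : C * τ ≤ 1 / 32) {t s : ℝ} (ht : t ∈ Ioo (-τ) τ)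
    (hs : s ∈ Ioo (-τ) τ) :
    ((s, p) ∈ flowDomain Ω Y ∧ (t, flow Ω Y s p) ∈ flowDomain Ω X) ∧
      ((t, p) ∈ flowDomain Ω X ∧ (s, flow Ω X t p) ∈ flowDomain Ω Y) ∧
      flow Ω X t (flow Ω Y s p) ∈ Ω ∧
      flow Ω X t (flow Ω Y s p) = flow Ω Y s (flow Ω X t p) := by
  have hcomplete : CompleteSpace E := FiniteDimensional.complete ℝ E
  have hC := hX.nonneg
  have hτ : 0 < τ := by linarith [ht.1, ht.2]
  have h0 : (0 : ℝ) ∈ Ioo (-τ) τ := ⟨by linarith, hτ⟩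
  have hball : ∀ {q : E} {r : ℝ}, q ∈ Metric.closedBall p r →
      Metric.closedBall q R ⊆ Metric.closedBall p (r + R) := fun hq ↦
    Metric.closedBall_subset_closedBall' (by linarith [Metric.mem_closedBall.1 hq])
  have hmono : ∀ {r : ℝ}, r ≤ 4 * R → Metric.closedBall p r ⊆ Metric.closedBall p (4 * R) :=
    fun h ↦ Metric.closedBall_subset_closedBall h
  have hsub : ∀ q ∈ Metric.closedBall p R,
      Metric.closedBall q R ⊆ Metric.closedBall p (4 * R) := fun q hq ↦
    (hball hq).trans (hmono (by linarith))
  -- solutions of the given fields and of the approximating fields through points near `p`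
  have hsol : ∀ {V : E → E} {Z : ℕ → E → E}, LogApprox V (Metric.closedBall p (4 * R)) C Z →
      ∀ q ∈ Metric.closedBall p R, ∃ x : ℝ → E, x 0 = q ∧
        (∀ t ∈ Ioo (-τ) τ, HasDerivAt x (V (x t)) t) ∧
          ∀ t ∈ Ioo (-τ) τ, x t ∈ Metric.closedBall q R := fun hV q hq ↦
    (hV.mono (hsub q hq)).exists_solution hR.le hτ hτR (hτC.trans (by norm_num))
  have hsolN : ∀ {V : E → E} {Z : ℕ → E → E}, LogApprox V (Metric.closedBall p (4 * R)) C Z →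
      ∀ N : ℕ, ∀ q ∈ Metric.closedBall p R, ∃ x : ℝ → E, x 0 = q ∧
        (∀ t ∈ Ioo (-τ) τ, HasDerivAt x (Z N (x t)) t) ∧
          ∀ t ∈ Ioo (-τ) τ, x t ∈ Metric.closedBall q R := fun hV N q hq ↦
    exists_solution_of_lipschitz (K := C * (N + 1)) hR.le hτ hC (by positivity) hτR (hV.bound N)
      ((hV.mono (hsub q hq)).lip N)
  have hpR : p ∈ Metric.closedBall p R := Metric.mem_closedBall_self hR.le
  obtain ⟨γ, hγ0, hγ, hγS⟩ := hsol hY p hpR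
  obtain ⟨x, hx0, hx, hxS⟩ := hsol hX (γ s) (hγS s hs)
  obtain ⟨η, hη0, hη, hηS⟩ := hsol hX p hpR
  obtain ⟨y, hy0, hy, hyS⟩ := hsol hY (η t) (hηS t ht)
  have hγ4 : ∀ t ∈ Ioo (-τ) τ, γ t ∈ Metric.closedBall p (4 * R) :=
    fun t ht ↦ hsub p hpR (hγS t ht)
  have hη4 : ∀ t ∈ Ioo (-τ) τ, η t ∈ Metric.closedBall p (4 * R) :=
    fun t ht ↦ hsub p hpR (hηS t ht)
  have hx4 : ∀ t ∈ Ioo (-τ) τ, x t ∈ Metric.closedBall p (4 * R) :=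
    fun t ht ↦ hsub _ (hγS s hs) (hxS t ht)
  have hy4 : ∀ s ∈ Ioo (-τ) τ, y s ∈ Metric.closedBall p (4 * R) :=
    fun s hs ↦ hsub _ (hηS t ht) (hyS s hs)
  obtain ⟨d1, f1⟩ := hYl.flow_eq (isSolution_Ioo hτ hγ0 hγ fun t ht ↦ hpΩ (hγ4 t ht)) hs
  obtain ⟨d2, f2⟩ := hXl.flow_eq (isSolution_Ioo hτ hx0 hx fun t ht ↦ hpΩ (hx4 t ht)) ht
  obtain ⟨d3, f3⟩ := hXl.flow_eq (isSolution_Ioo hτ hη0 hη fun t ht ↦ hpΩ (hη4 t ht)) ht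
  obtain ⟨d4, f4⟩ := hYl.flow_eq (isSolution_Ioo hτ hy0 hy fun t ht ↦ hpΩ (hy4 t ht)) hs
  rw [f1, f2, f3, f4]
  refine ⟨⟨d1, d2⟩, ⟨d3, d4⟩, hpΩ (hx4 t ht), ?_⟩
  set e : ℕ → ℝ := fun N ↦ Real.exp (-(N / 2)) with he
  set g : ℕ → ℝ := fun N ↦ Real.exp (1 / 32 * (N + 1)) with hg
  -- with `u s` (first `ZY N`, then `ZX N`) and `v` (first `ZX N`, then `ZY N`), both end points are
  -- close to the exact ones, and close to each other by the commutator estimate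
  have key : ∀ N : ℕ, ‖x t - y s‖ ≤
      (4 * C * τ + τ * τ * C) * Real.exp (-(N * (1 / 2))) * Real.exp (1 / 8 * (N + 1)) := by
    intro N
    obtain ⟨γN, hγN0, hγN, hγNS⟩ := hsolN hY N p hpR
    have hu : ∀ σ ∈ Ioo (-τ) τ, ∃ z : ℝ → E, z 0 = γN σ ∧
        (∀ t ∈ Ioo (-τ) τ, HasDerivAt z (ZX N (z t)) t) ∧
          ∀ t ∈ Ioo (-τ) τ, z t ∈ Metric.closedBall (γN σ) R :=
      fun σ hσ ↦ hsolN hX N _ (hγNS σ hσ)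
    choose! u hu0 hu huS using hu
    have hu0t : u 0 t ∈ Metric.closedBall p R := by
      have := huS 0 h0 t ht
      rwa [hγN0] at this
    obtain ⟨v, hv0, hv, hvS⟩ := hsolN hY N (u 0 t) hu0t
    have hR2 : R + R = 2 * R := by ring
    have hu2 : ∀ σ ∈ Ioo (-τ) τ, ∀ θ ∈ Ioo (-τ) τ, u σ θ ∈ Metric.closedBall p (2 * R) :=
      fun σ hσ θ hθ ↦ hR2 ▸ hball (hγNS σ hσ) (huS σ hσ θ hθ)
    have hv2 : ∀ σ ∈ Ioo (-τ) τ, v σ ∈ Metric.closedBall p (2 * R) :=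
      fun σ hσ ↦ hR2 ▸ hball hu0t (hvS σ hσ)
    have h24 := hmono (by linarith : 2 * R ≤ 4 * R)
    have he0 : 0 ≤ e N := (Real.exp_pos _).le
    have hg0 : 0 ≤ g N := (Real.exp_pos _).le
    have hcomm : ‖u s t - v s‖ ≤ τ * τ * (C * e N) * (g N * g N) := by
      have h4 : 2 * (2 * R) = 4 * R := by ring
      have hsτ := (abs_lt.2 hs).le
      have htτ := (abs_lt.2 ht).le
      have := norm_flow_commutator_le_abs (X := ZX N) (Y := ZY N) (p := p) (R := 2 * R)
        (K := C * (N + 1)) (β := C * e N) (M := C) (hXs N)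
        ((hYs N).differentiable (by norm_num)) (by linarith) (by positivity) (by positivity)
        (h4 ▸ hX.lip N) (h4 ▸ hY.lip N) (hY.bound N) (fun x hx ↦ hbr N x (h24 hx)) hγN hu0 hu hu2
        hs ht hv hv2 hv0
      refine this.trans ?_
      have hexp : Real.exp (C * (N + 1) * (|s| + |t|)) ≤ g N * g N := by
        rw [hg, ← Real.exp_add, Real.exp_le_exp]
        calc C * (N + 1) * (|s| + |t|) ≤ C * (N + 1) * (τ + τ) := by gcongr
          _ = C * τ * (N + 1) + C * τ * (N + 1) := by ring
          _ ≤ 1 / 32 * (N + 1) + 1 / 32 * (N + 1) := by gcongr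
      gcongr
    have h1 := hY.norm_sub_le_of_solutions hτC N hγN (fun t ht ↦ hsub p hpR (hγNS t ht)) hγ hγ4 s hs
    have h2 := hX.norm_sub_le_of_solutions hτC N (hu s hs) (fun t ht ↦ h24 (hu2 s hs t ht)) hx hx4
      t ht
    have h3 := hX.norm_sub_le_of_solutions hτC N (hu 0 h0) (fun t ht ↦ h24 (hu2 0 h0 t ht)) hη hη4
      t ht
    have h4 := hY.norm_sub_le_of_solutions hτC N hv (fun t ht ↦ h24 (hv2 t ht)) hy hy4 s hs
    rw [hγN0, hγ0, sub_self, norm_zero, zero_add] at h1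
    rw [hu0 s hs, hx0] at h2
    rw [hu0 0 h0, hγN0, hη0, sub_self, norm_zero, zero_add] at h3
    rw [hv0, hy0] at h4
    have hg1 : 1 ≤ g N := Real.one_le_exp (by positivity)
    have habs : ∀ D d : ℝ, d ≤ C * e N * τ * g N → D ≤ (d + C * e N * τ) * g N →
        D ≤ 2 * (C * e N * τ) * (g N * g N) := by
      intro D d hd hD
      have hA : 0 ≤ C * e N * τ := by positivity
      calc D ≤ (d + C * e N * τ) * g N := hD
        _ ≤ (C * e N * τ * g N + C * e N * τ * g N) * g N := by
            exact mul_le_mul_of_nonneg_right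
              (add_le_add hd (le_mul_of_one_le_right hA hg1)) hg0
        _ = _ := by ring
    have h5 := habs _ _ h1 h2
    have h6 := habs _ _ h3 h4
    have hgg : g N * g N ≤ Real.exp (1 / 8 * (N + 1)) := by
      rw [hg, ← Real.exp_add, Real.exp_le_exp]
      linarith [(Nat.cast_nonneg N : (0 : ℝ) ≤ N)]
    calc ‖x t - y s‖ = ‖(u s t - v s) + (v s - y s) - (u s t - x t)‖ := by congr 1; abel
      _ ≤ ‖u s t - v s‖ + ‖v s - y s‖ + ‖u s t - x t‖ :=
          (norm_sub_le _ _).trans (by gcongr; exact norm_add_le _ _)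
      _ ≤ τ * τ * (C * e N) * (g N * g N) + 2 * (C * e N * τ) * (g N * g N) +
          2 * (C * e N * τ) * (g N * g N) := by gcongr
      _ = (4 * C * τ + τ * τ * C) * e N * (g N * g N) := by ring
      _ ≤ (4 * C * τ + τ * τ * C) * e N * Real.exp (1 / 8 * (N + 1)) := by gcongr
      _ = _ := by rw [he]; simp only; rw [show (N : ℝ) / 2 = N * (1 / 2) by ring]
  have h3 : ‖x t - y s‖ ≤ 0 :=
    ge_of_tendsto' (tendsto_mul_exp_mul_exp (by norm_num : (1 : ℝ) / 8 < 1 / 2)) key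
  exact sub_eq_zero.1 (norm_le_zero_iff.1 h3)

end Commutation

section Young

variable {E : Type*} [NormedAddCommGroup E] [NormedSpace ℝ E] [FiniteDimensional ℝ E]
  [MeasureSpace E] [BorelSpace E] [(volume : Measure E).IsAddHaarMeasure]

/-! ### A Young estimate for difference quotients -/

/-- The pairing `∫ D_h ψ · A` of `A` with the difference quotient `D_h ψ` of `ψ` in direction
`e`. -/
noncomputable def diffPairing (e : E) (ψ A : E → ℝ) (h : ℝ) : ℝ :=
  ∫ x, (ψ (x + h • e) - ψ x) / h * A x

/-- `ψ` is continuous and supported in the compact set `K`, its increments in direction `e` are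
`α`-Hölder with constant `a`, and those of `A` near `K` are `β`-Hölder with constant `b`,
for steps up to `h₀`. -/
structure YoungPair (K : Set E) (e : E) (h₀ α β a b : ℝ) (ψ A : E → ℝ) : Prop where
  isCompact : IsCompact K
  norm_dir : ‖e‖ ≤ 1
  pos : 0 < h₀
  left_nonneg : 0 ≤ a
  right_nonneg : 0 ≤ b
  continuous : Continuous ψ
  eq_zero : ∀ x ∉ K, ψ x = 0
  incr_left : ∀ h ∈ Ioc 0 h₀, ∀ x, |ψ (x + h • e) - ψ x| ≤ a * h ^ α
  aesm : AEStronglyMeasurable A volume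
  bdd : ∃ B, ∀ x, |A x| ≤ B
  incr_right : ∀ h ∈ Ioc 0 h₀, ∀ x, x ∈ K ∨ x + h • e ∈ K → |A x - A (x - h • e)| ≤ b * h ^ β

lemma mem_cthickening_of_mem_or {K : Set E} {e : E} {h h₀ : ℝ} (he : ‖e‖ ≤ 1) (hh : 0 ≤ h)
    (hh₀ : h ≤ h₀) {x : E} (hx : x ∈ K ∨ x + h • e ∈ K) : x ∈ Metric.cthickening h₀ K := by
  rcases hx with hx | hx
  · exact Metric.self_subset_cthickening K hx
  · refine Metric.mem_cthickening_of_dist_le x _ h₀ K hx ?_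
    rw [dist_eq_norm, sub_add_cancel_left, norm_neg, norm_smul, Real.norm_of_nonneg hh]
    nlinarith [norm_nonneg e]

lemma abs_integral_le_of_eq_zero_off {K : Set E} (hK : IsCompact K) {e : E} {h h₀ c : ℝ}
    (he : ‖e‖ ≤ 1) (hh : 0 ≤ h) (hh₀ : h ≤ h₀) (hc : 0 ≤ c) {f : E → ℝ}
    (hf : ∀ x, ¬ (x ∈ K ∨ x + h • e ∈ K) → f x = 0)
    (hfc : ∀ x, x ∈ K ∨ x + h • e ∈ K → |f x| ≤ c) :
    |∫ x, f x| ≤ c * volume.real (Metric.cthickening h₀ K) := by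
  have := FiniteDimensional.proper_real E
  rw [← Real.norm_eq_abs,
    ← setIntegral_eq_integral_of_forall_compl_eq_zero (s := Metric.cthickening h₀ K)]
  · refine norm_setIntegral_le_of_norm_le_const (μ := volume)
      hK.cthickening.measure_lt_top fun x _ ↦ ?_
    by_cases hx : x ∈ K ∨ x + h • e ∈ K
    · exact hfc x hx
    · rw [hf x hx, norm_zero]; exact hc
  · exact fun x hx ↦ hf x fun h' ↦ hx (mem_cthickening_of_mem_or he hh hh₀ h')

lemma integrable_mul_bounded {ψ A : E → ℝ} (hψ : Continuous ψ) (hψc : HasCompactSupport ψ)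
    (hA : AEStronglyMeasurable A volume) {B : ℝ} (hB : ∀ x, |A x| ≤ B) :
    Integrable (fun x ↦ ψ x * A x) :=
  (hψ.integrable_of_hasCompactSupport hψc).mul_bdd hA (Eventually.of_forall hB)

lemma hasCompactSupport_comp_add {ψ : E → ℝ} (hψ : HasCompactSupport ψ) (v : E) :
    HasCompactSupport (fun x ↦ ψ (x + v)) :=
  hψ.comp_homeomorph (Homeomorph.addRight v)

lemma integrable_diff_mul {ψ A : E → ℝ} (hψ : Continuous ψ) (hψc : HasCompactSupport ψ)
    (hA : AEStronglyMeasurable A volume) {B : ℝ} (hB : ∀ x, |A x| ≤ B) (v w : E) (c : ℝ) :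
    Integrable (fun x ↦ (ψ (x + v) - ψ (x + w)) / c * A x) := by
  refine integrable_mul_bounded (by fun_prop) ?_ hA hB
  have : HasCompactSupport (fun x ↦ ψ (x + v) - ψ (x + w)) :=
    (hasCompactSupport_comp_add hψc v).sub (hasCompactSupport_comp_add hψc w)
  exact this.comp_left (g := fun y ↦ y / c) (by simp)

namespace YoungPair

variable {K : Set E} {e : E} {h₀ α β a b : ℝ} {ψ A : E → ℝ}

lemma hasCompactSupport (P : YoungPair K e h₀ α β a b ψ A) : HasCompactSupport ψ :=
  HasCompactSupport.intro P.isCompact P.eq_zero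

lemma diff_eq_zero (P : YoungPair K e h₀ α β a b ψ A) {h : ℝ} {x : E}
    (hx : ¬ (x ∈ K ∨ x + h • e ∈ K)) : ψ (x + h • e) - ψ x = 0 := by
  rw [not_or] at hx
  rw [P.eq_zero _ hx.1, P.eq_zero _ hx.2, sub_zero]

/-- Halving the step changes the difference quotient pairing by `O(h ^ (α + β - 1))`: writing
`D_{2h} ψ` as the mean of `D_h ψ` and its translate by `h`, translation invariance moves the
translate to `A`. -/
lemma abs_diffPairing_sub_double_le (P : YoungPair K e h₀ α β a b ψ A) {h : ℝ}
    (hh : h ∈ Ioc 0 h₀) :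
    |diffPairing e ψ A h - diffPairing e ψ A (2 * h)| ≤
      a * b * h ^ (α + β - 1) * volume.real (Metric.cthickening h₀ K) := by
  obtain ⟨B, hB⟩ := P.bdd
  have hh0 := hh.1
  have hc := P.hasCompactSupport
  have hint : ∀ v w : E, ∀ c : ℝ, Integrable (fun x ↦ (ψ (x + v) - ψ (x + w)) / c * A x) :=
    integrable_diff_mul P.continuous hc P.aesm hB
  have hint0 : ∀ v : E, ∀ c : ℝ, Integrable (fun x ↦ (ψ (x + v) - ψ x) / c * A x) := fun v c ↦ by
    simpa using hint v 0 c
  have htrans : ∀ f : E → ℝ, ∫ x, f (x - h • e) = ∫ x, f x := fun f ↦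
    integral_sub_right_eq_self f (h • e)
  have hshift : ∀ x : E, x - h • e + h • e = x := fun x ↦ sub_add_cancel _ _
  have hshift2 : ∀ x : E, x - h • e + (2 * h) • e = x + h • e := fun x ↦ by
    rw [two_mul, add_smul]; abel
  have h2 : diffPairing e ψ A (2 * h) =
      (∫ x, (ψ (x + h • e) - ψ x) / (2 * h) * A (x - h • e)) +
        ∫ x, (ψ (x + h • e) - ψ x) / (2 * h) * A x := by
    rw [diffPairing]
    have h3 : (∫ x, (ψ (x + h • e) - ψ x) / (2 * h) * A (x - h • e)) =
        ∫ x, (ψ (x + (2 * h) • e) - ψ (x + h • e)) / (2 * h) * A x := by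
      rw [← htrans (fun x ↦ (ψ (x + (2 * h) • e) - ψ (x + h • e)) / (2 * h) * A x)]
      simp only [hshift, hshift2]
    rw [h3, ← integral_add (hint _ _ _) (hint0 _ _)]
    congr 1 with x
    ring
  have hint3 : Integrable (fun x ↦ (ψ (x + h • e) - ψ x) / (2 * h) * A (x - h • e)) := by
    have := (hint ((2 * h) • e) (h • e) (2 * h)).comp_sub_right (h • e)
    simpa only [hshift, hshift2] using this
  have h4 : diffPairing e ψ A h - diffPairing e ψ A (2 * h) =
      ∫ x, (ψ (x + h • e) - ψ x) / (2 * h) * (A x - A (x - h • e)) := by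
    have hsum : Integrable (fun x ↦ (ψ (x + h • e) - ψ x) / (2 * h) * A (x - h • e) +
        (ψ (x + h • e) - ψ x) / (2 * h) * A x) := hint3.add (hint0 _ _)
    rw [h2, diffPairing, ← integral_add hint3 (hint0 _ _), ← integral_sub (hint0 _ _) hsum]
    congr 1 with x
    field_simp
    ring
  have ha := P.left_nonneg
  have hb := P.right_nonneg
  rw [h4]
  refine abs_integral_le_of_eq_zero_off P.isCompact P.norm_dir hh0.le hh.2 (by positivity) ?_ ?_
  · intro x hx
    rw [P.diff_eq_zero hx, zero_div, zero_mul]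
  · intro x hx
    rw [abs_mul, abs_div, abs_of_pos (by positivity : 0 < 2 * h)]
    calc |ψ (x + h • e) - ψ x| / (2 * h) * |A x - A (x - h • e)|
        ≤ a * h ^ α / (2 * h) * (b * h ^ β) := by
          gcongr
          · exact P.incr_left h hh x
          · exact P.incr_right h hh x hx
      _ = a * b * h ^ (α + β - 1) / 2 := by
          rw [Real.rpow_sub hh0, Real.rpow_add hh0, Real.rpow_one]
          field_simp
      _ ≤ a * b * h ^ (α + β - 1) := half_le_self (by positivity)

/-- The sum of the geometric series of the bounds of `abs_diffPairing_sub_double_le`, along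
`h = h₀ / 2 ^ k`. -/
lemma abs_diffPairing_sub_le_of_tendsto (P : YoungPair K e h₀ α β a b ψ A) (hαβ : 1 < α + β)
    {l : ℝ} (hl : Tendsto (fun k : ℕ ↦ diffPairing e ψ A (h₀ / 2 ^ k)) atTop (𝓝 l)) (k : ℕ) :
    |diffPairing e ψ A (h₀ / 2 ^ k) - l| ≤
      a * b * h₀ ^ (α + β - 1) * volume.real (Metric.cthickening h₀ K) *
        ((1 / 2) ^ (α + β - 1)) ^ k / (1 - (1 / 2) ^ (α + β - 1)) := by
  have ha := P.left_nonneg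
  have hb := P.right_nonneg
  have h0 := P.pos
  have hr1 : (1 / 2 : ℝ) ^ (α + β - 1) < 1 :=
    Real.rpow_lt_one (by norm_num) (by norm_num) (by linarith)
  refine dist_le_of_le_geometric_of_tendsto _ _ hr1 (fun n ↦ ?_) hl k
  have hpow : (0 : ℝ) < 2 ^ (n + 1) := by positivity
  have hle : h₀ / 2 ^ (n + 1) ≤ h₀ := div_le_self h0.le (one_le_pow₀ (by norm_num))
  have := P.abs_diffPairing_sub_double_le (h := h₀ / 2 ^ (n + 1)) ⟨by positivity, hle⟩
  have h2 : 2 * (h₀ / 2 ^ (n + 1)) = h₀ / 2 ^ n := by rw [pow_succ]; field_simp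
  rw [h2, abs_sub_comm] at this
  refine this.trans ?_
  have h3 : (h₀ / 2 ^ (n + 1)) ^ (α + β - 1) ≤
      h₀ ^ (α + β - 1) * ((1 / 2) ^ (α + β - 1)) ^ n := by
    have h4 : h₀ / 2 ^ (n + 1) = h₀ * (1 / 2) ^ (n + 1) := by rw [one_div, inv_pow]; ring
    rw [h4, Real.mul_rpow h0.le (by positivity), ← Real.rpow_natCast, ← Real.rpow_mul (by norm_num),
      mul_comm ((n + 1 : ℕ) : ℝ), Real.rpow_mul (by norm_num), Real.rpow_natCast, pow_succ]
    gcongr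
    exact mul_le_of_le_one_right (by positivity) hr1.le
  calc _ ≤ a * b * (h₀ ^ (α + β - 1) * ((1 / 2) ^ (α + β - 1)) ^ n) *
        volume.real (Metric.cthickening h₀ K) := by gcongr
    _ = _ := by ring

lemma abs_diffPairing_le (P : YoungPair K e h₀ α β a b ψ A) {c h : ℝ} (hh : h ∈ Ioc 0 h₀)
    (hc : 0 ≤ c) (hA : ∀ x, x ∈ K ∨ x + h • e ∈ K → |A x| ≤ c) :
    |diffPairing e ψ A h| ≤ a * h ^ α / h * c * volume.real (Metric.cthickening h₀ K) := by
  have ha := P.left_nonneg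
  have hh0 := hh.1
  refine abs_integral_le_of_eq_zero_off P.isCompact P.norm_dir hh.1.le hh.2 (by positivity) ?_ ?_
  · intro x hx
    rw [P.diff_eq_zero hx, zero_div, zero_mul]
  · intro x hx
    rw [abs_mul, abs_div, abs_of_pos hh0]
    gcongr
    · exact P.incr_left h hh x
    · exact hA x hx

lemma diffPairing_sub_const (P : YoungPair K e h₀ α β a b ψ A) (c h : ℝ) :
    diffPairing e ψ (fun x ↦ A x - c) h = diffPairing e ψ A h := by
  obtain ⟨B, hB⟩ := P.bdd
  have hψi := P.continuous.integrable_of_hasCompactSupport (μ := volume) P.hasCompactSupport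
  have hψs : Integrable (fun x ↦ ψ (x + h • e)) := hψi.comp_add_right (h • e)
  have h1 : ∫ x, (ψ (x + h • e) - ψ x) / h * c = 0 := by
    rw [integral_mul_const, integral_div, integral_sub hψs hψi,
      integral_add_right_eq_self ψ (h • e), sub_self, zero_div, zero_mul]
  have hi := integrable_diff_mul P.continuous P.hasCompactSupport P.aesm hB (h • e) 0 h
  simp only [add_zero] at hi
  have hi2 : Integrable (fun x ↦ (ψ (x + h • e) - ψ x) / h * c) :=
    ((hψs.sub hψi).div_const h).mul_const c
  simp only [diffPairing, mul_sub]
  rw [integral_sub hi hi2, h1, sub_zero]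

end YoungPair

lemma tendsto_div_two_pow {h₀ : ℝ} (hh₀ : 0 < h₀) :
    Tendsto (fun k : ℕ ↦ h₀ / 2 ^ k) atTop (𝓝[≠] 0) := by
  refine tendsto_nhdsWithin_iff.2 ⟨?_, Eventually.of_forall fun k ↦ ?_⟩
  · have := (tendsto_pow_atTop_nhds_zero_of_lt_one (r := (1 / 2 : ℝ)) (by norm_num)
      (by norm_num)).const_mul h₀
    simpa [div_eq_mul_inv] using this
  · have : 0 < h₀ / 2 ^ k := by positivity
    exact this.ne'

lemma tendsto_diffPairing {e : E} {ψ A : E → ℝ} {h₀ B : ℝ} (hh₀ : 0 < h₀) (he : ‖e‖ ≤ 1)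
    (hψ : ContDiff ℝ 1 ψ) (hψc : HasCompactSupport ψ) (hA : AEStronglyMeasurable A volume)
    (hB : ∀ x, |A x| ≤ B) :
    Tendsto (fun k : ℕ ↦ diffPairing e ψ A (h₀ / 2 ^ k)) atTop
      (𝓝 (∫ x, fderiv ℝ ψ x e * A x)) := by
  have := FiniteDimensional.proper_real E
  obtain ⟨L, hL⟩ := ContDiff.lipschitzWith_of_hasCompactSupport hψc hψ (by norm_num)
  set K := tsupport ψ with hK
  have hKc : IsCompact K := hψc
  refine tendsto_integral_of_dominated_convergence
    ((Metric.cthickening h₀ K).indicator fun _ ↦ (L : ℝ) * B) (fun k ↦ ?_) ?_ (fun k ↦ ?_) ?_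
  · have := (integrable_diff_mul hψ.continuous hψc hA hB ((h₀ / 2 ^ k) • e) 0
      (h₀ / 2 ^ k)).aestronglyMeasurable
    simpa using this
  · rw [integrable_indicator_iff Metric.isClosed_cthickening.measurableSet]
    exact integrableOn_const (hKc.cthickening.measure_lt_top.ne)
  · refine Eventually.of_forall fun x ↦ ?_
    have hpos : 0 < h₀ / 2 ^ k := by positivity
    have hle : h₀ / 2 ^ k ≤ h₀ := div_le_self hh₀.le (one_le_pow₀ (by norm_num))
    by_cases hx : x ∈ Metric.cthickening h₀ K
    · rw [indicator_of_mem hx, norm_mul, norm_div, Real.norm_of_nonneg hpos.le]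
      gcongr
      · rw [div_le_iff₀ hpos]
        have h1 := hL.norm_sub_le (x + (h₀ / 2 ^ k) • e) x
        rw [add_sub_cancel_left, norm_smul, Real.norm_of_nonneg hpos.le] at h1
        refine h1.trans ?_
        gcongr
        nlinarith
      · exact hB x
    · have h1 : ¬ (x ∈ K ∨ x + (h₀ / 2 ^ k) • e ∈ K) := fun h' ↦
        hx (mem_cthickening_of_mem_or he hpos.le hle h')
      rw [not_or] at h1
      rw [image_eq_zero_of_notMem_tsupport h1.1, image_eq_zero_of_notMem_tsupport h1.2]
      simp [hx]
  · refine Eventually.of_forall fun x ↦ Tendsto.mul_const _ ?_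
    have h1 := ((hψ.differentiable (by norm_num) x).hasFDerivAt.hasLineDerivAt e).tendsto_slope_zero
    refine (h1.comp (tendsto_div_two_pow hh₀)).congr fun k ↦ ?_
    exact (div_eq_inv_mul _ _).symm

/-- Young's estimate for `∫ ∂ₑψ · A`, with a constant depending only on `K`, `h₀`, `α` and `β`. -/
lemma YoungPair.abs_integral_fderiv_mul_le {K : Set E} {e : E} {h₀ α β a b c : ℝ} {ψ A : E → ℝ}
    (P : YoungPair K e h₀ α β a b ψ A) (hαβ : 1 < α + β) (hψ : ContDiff ℝ 1 ψ) (hc : 0 ≤ c)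
    (hA : ∀ x, |A x| ≤ c) :
    |∫ x, fderiv ℝ ψ x e * A x| ≤ a * (b * (h₀ ^ (α + β - 1) / (1 - (1 / 2) ^ (α + β - 1))) +
      c * (h₀ ^ α / h₀)) * volume.real (Metric.cthickening h₀ K) := by
  have h1 := P.abs_diffPairing_sub_le_of_tendsto hαβ
    (tendsto_diffPairing P.pos P.norm_dir hψ P.hasCompactSupport P.aesm hA) 0
  have h2 := P.abs_diffPairing_le (h := h₀) ⟨P.pos, le_rfl⟩ hc (fun x _ ↦ hA x)
  simp only [pow_zero, div_one, mul_one] at h1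
  set V := volume.real (Metric.cthickening h₀ K)
  have h3 := abs_sub_abs_le_abs_sub (∫ x, fderiv ℝ ψ x e * A x) (diffPairing e ψ A h₀)
  rw [abs_sub_comm] at h3
  calc _ ≤ a * b * h₀ ^ (α + β - 1) * V / (1 - (1 / 2) ^ (α + β - 1)) +
        a * h₀ ^ α / h₀ * c * V := by linarith
    _ = _ := by ring

end Young

/-! ### Hölder regularity of log-Lipschitz functions -/

lemma etaLog_nonneg {r : ℝ} (hr : 0 ≤ r) : 0 ≤ etaLog r := by
  unfold etaLog
  split_ifs with h
  · rcases hr.eq_or_lt with rfl | hr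
    · simp
    refine mul_nonneg hr.le (Real.log_nonneg ?_)
    rw [one_le_div hr]
    exact h.trans (inv_le_one_of_one_le₀ (Real.one_le_exp zero_le_one))
  · positivity

lemma etaLog_le_rpow {r β : ℝ} (hr : 0 ≤ r) (hβ : β ∈ Ioo (0 : ℝ) 1) :
    etaLog r ≤ (1 - β)⁻¹ * r ^ β := by
  have h1β : 0 < 1 - β := by linarith [hβ.2]
  unfold etaLog
  split_ifs with h
  · rcases hr.eq_or_lt with rfl | hr
    · rw [zero_mul]
      positivity
    have h1 := Real.log_le_rpow_div (x := 1 / r) (by positivity) h1β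
    calc r * Real.log (1 / r) ≤ r * ((1 / r) ^ (1 - β) / (1 - β)) := by gcongr
      _ = (1 - β)⁻¹ * r ^ β := by
        rw [one_div, Real.inv_rpow hr.le, ← Real.rpow_neg hr.le, neg_sub,
          Real.rpow_sub hr, Real.rpow_one]
        field_simp
  · have he : (0 : ℝ) < (Real.exp 1)⁻¹ := by positivity
    have he1 : (Real.exp 1)⁻¹ ≤ 1 := inv_le_one_of_one_le₀ (Real.one_le_exp zero_le_one)
    calc (Real.exp 1)⁻¹ ≤ (Real.exp 1)⁻¹ ^ β := by
          simpa using Real.rpow_le_rpow_of_exponent_ge he he1 hβ.2.le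
      _ ≤ r ^ β := Real.rpow_le_rpow he.le (not_le.1 h).le hβ.1.le
      _ ≤ (1 - β)⁻¹ * r ^ β := le_mul_of_one_le_left (by positivity)
        ((one_le_inv₀ h1β).2 (by linarith [hβ.1]))

section Holder

variable {E F : Type*} [NormedAddCommGroup E] [NormedAddCommGroup F]

lemma IsLogLipschitz.exists_holderBound {Ω : Opens E} {f : E → F} (h : IsLogLipschitz Ω f)
    {β : ℝ} (hβ : β ∈ Ioo (0 : ℝ) 1) : ∃ C, 0 ≤ C ∧ HolderBound (Ω : Set E) β f C := by
  obtain ⟨C, h1, h2⟩ := h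
  have h1β : 0 < 1 - β := by linarith [hβ.2]
  refine ⟨|C| * (1 - β)⁻¹, by positivity, fun x hx ↦ ?_, fun x hx y hy ↦ ?_⟩
  · exact (h1 x hx).trans ((le_abs_self C).trans (le_mul_of_one_le_right (abs_nonneg _)
      ((one_le_inv₀ h1β).2 (by linarith [hβ.1]))))
  · calc ‖f x - f y‖ ≤ C * etaLog ‖x - y‖ := h2 x hx y hy
      _ ≤ |C| * etaLog ‖x - y‖ := by
        gcongr
        · exact etaLog_nonneg (norm_nonneg _)
        · exact le_abs_self C
      _ ≤ |C| * ((1 - β)⁻¹ * ‖x - y‖ ^ β) := by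
        gcongr
        exact etaLog_le_rpow (norm_nonneg _) hβ
      _ = _ := by ring

lemma HolderBound.mono {S S' : Set E} {α : ℝ} {f : E → F} {C : ℝ} (h : HolderBound S α f C)
    (hS : S' ⊆ S) : HolderBound S' α f C :=
  ⟨fun x hx ↦ h.1 x (hS hx), fun x hx y hy ↦ h.2 x (hS hx) y (hS hy)⟩

lemma HolderBound.mono_const {S : Set E} {α : ℝ} {f : E → F} {C C' : ℝ} (h : HolderBound S α f C)
    (hC : C ≤ C') : HolderBound S α f C' :=
  ⟨fun x hx ↦ (h.1 x hx).trans hC, fun x hx y hy ↦ (h.2 x hx y hy).trans (by gcongr)⟩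

lemma HolderBound.add {S : Set E} {α : ℝ} {f g : E → F} {C C' : ℝ} (hf : HolderBound S α f C)
    (hg : HolderBound S α g C') : HolderBound S α (f + g) (C + C') := by
  refine ⟨fun x hx ↦ (norm_add_le _ _).trans (add_le_add (hf.1 x hx) (hg.1 x hx)),
    fun x hx y hy ↦ ?_⟩
  rw [Pi.add_apply, Pi.add_apply, add_sub_add_comm, add_mul]
  exact (norm_add_le _ _).trans (add_le_add (hf.2 x hx y hy) (hg.2 x hx y hy))

lemma HolderBound.continuousOn {S : Set E} {α : ℝ} (hα : 0 < α) {f : E → F} {C : ℝ}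
    (h : HolderBound S α f C) : ContinuousOn f S := by
  intro x hx
  rw [ContinuousWithinAt, tendsto_iff_norm_sub_tendsto_zero]
  refine squeeze_zero' (Eventually.of_forall fun _ ↦ norm_nonneg _)
    (eventually_nhdsWithin_of_forall fun y hy ↦ h.2 y hy x hx) ?_
  have h1 : Tendsto (fun y ↦ ‖y - x‖) (𝓝[S] x) (𝓝 0) :=
    tendsto_iff_norm_sub_tendsto_zero.1 nhdsWithin_le_nhds
  have := (h1.rpow_const (p := α) (Or.inr hα.le)).const_mul C
  simpa [Real.zero_rpow hα.ne'] using this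

lemma HolderBound.apply {n : ℕ} {S : Set E} {α : ℝ} {f : E → EuclideanSpace ℝ (Fin n)} {C : ℝ}
    (h : HolderBound S α f C) (i : Fin n) : HolderBound S α (fun x ↦ f x i) C :=
  ⟨fun x hx ↦ (PiLp.norm_apply_le (f x) i).trans (h.1 x hx), fun x hx y hy ↦
    (PiLp.norm_apply_le (f x - f y) i).trans (h.2 x hx y hy)⟩

end Holder

section Young

variable {E : Type*} [NormedAddCommGroup E] [NormedSpace ℝ E] [FiniteDimensional ℝ E]
  [MeasureSpace E] [BorelSpace E] [(volume : Measure E).IsAddHaarMeasure]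

lemma contDiff_mul_of_tsupport_subset {Ω : Set E} (hΩ : IsOpen Ω) {f φ : E → ℝ} {k : WithTop ℕ∞}
    (hf : ContDiffOn ℝ k f Ω) (hφ : ContDiff ℝ k φ) (hφΩ : tsupport φ ⊆ Ω) :
    ContDiff ℝ k (fun x ↦ f x * φ x) := by
  rw [contDiff_iff_contDiffAt]
  intro x
  by_cases hx : x ∈ Ω
  · exact (hf.contDiffAt (hΩ.mem_nhds hx)).mul hφ.contDiffAt
  · have h0 : φ =ᶠ[𝓝 x] 0 := notMem_tsupport_iff_eventuallyEq.1 fun h ↦ hx (hφΩ h)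
    refine (contDiffAt_const (c := (0 : ℝ))).congr_of_eventuallyEq ?_
    filter_upwards [h0] with y hy
    rw [hy, Pi.zero_apply, mul_zero]

lemma continuous_mul_of_tsupport_subset {Ω : Set E} (hΩ : IsOpen Ω) {f φ : E → ℝ}
    (hf : ContinuousOn f Ω) (hφ : Continuous φ) (hφΩ : tsupport φ ⊆ Ω) :
    Continuous (fun x ↦ f x * φ x) :=
  (contDiff_mul_of_tsupport_subset hΩ (contDiffOn_zero.2 hf) (contDiff_zero.2 hφ)
    hφΩ).continuous

lemma aestronglyMeasurable_indicator {F : Type*} [NormedAddCommGroup F]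
    [SecondCountableTopology F] {Ω : Set E} (hΩ : IsOpen Ω) {f : E → F} (hf : ContinuousOn f Ω) :
    AEStronglyMeasurable (Ω.indicator f) volume :=
  (aestronglyMeasurable_indicator_iff hΩ.measurableSet).2
    (hf.aestronglyMeasurable hΩ.measurableSet)

/-- A Young pair `(f φ, A)` from a Hölder function `f`, a Lipschitz cutoff `φ` and a Hölder
function `A`. -/
lemma YoungPair.of_mul {K S : Set E} {e : E} {h₀ α β b m H M L : ℝ} {f φ A : E → ℝ}
    (hK : IsCompact K) (he : ‖e‖ ≤ 1) (hh₀ : 0 < h₀) (hα : α ∈ Ioo (0 : ℝ) 1)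
    (hβ : β ∈ Ioo (0 : ℝ) 1) (hS : Metric.cthickening (2 * h₀) K ⊆ S) (hm : 0 ≤ m) (hH : 0 ≤ H)
    (hM : 0 ≤ M) (hL : 0 ≤ L) (hfm : ∀ x ∈ S, |f x| ≤ m)
    (hfH : ∀ x ∈ S, ∀ y ∈ S, |f x - f y| ≤ H * ‖x - y‖ ^ α)
    (hφM : ∀ x, |φ x| ≤ M) (hφL : ∀ x y, |φ x - φ y| ≤ L * ‖x - y‖) (hφK : ∀ x ∉ K, φ x = 0)
    (hc : Continuous fun x ↦ f x * φ x) (hA : AEStronglyMeasurable A volume)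
    (hAb : ∃ B, ∀ x, |A x| ≤ B) (hb : 0 ≤ b)
    (hAS : ∀ x ∈ S, ∀ y ∈ S, |A x - A y| ≤ b * ‖x - y‖ ^ β) :
    YoungPair K e h₀ α β (H * M + m * (L * h₀ ^ (1 - α))) b (fun x ↦ f x * φ x) A where
  isCompact := hK
  norm_dir := he
  pos := hh₀
  left_nonneg := by positivity
  right_nonneg := hb
  continuous := hc
  eq_zero x hx := by rw [hφK x hx, mul_zero]
  incr_left := by
    intro h hh x
    have hh0 := hh.1
    by_cases hx : x ∈ K ∨ x + h • e ∈ K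
    · have hx1 : x ∈ S := hS (mem_cthickening_of_mem_or he hh.1.le (by linarith [hh.2]) hx)
      have hx2 : x + h • e ∈ S := by
        refine hS (mem_cthickening_of_mem_or (h := h) (e := -e) (by rwa [norm_neg]) hh.1.le
          (by linarith [hh.2]) ?_)
        rw [smul_neg, add_neg_cancel_right]
        exact hx.symm
      have hstep : ‖x + h • e - x‖ ≤ h := by
        rw [add_sub_cancel_left, norm_smul, Real.norm_of_nonneg hh0.le]
        nlinarith
      have h1 := hfH _ hx2 _ hx1
      have h2 := hφL (x + h • e) x
      calc |f (x + h • e) * φ (x + h • e) - f x * φ x|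
          = |(f (x + h • e) - f x) * φ (x + h • e) + f x * (φ (x + h • e) - φ x)| := by
            congr 1; ring
        _ ≤ |f (x + h • e) - f x| * |φ (x + h • e)| + |f x| * |φ (x + h • e) - φ x| :=
            (abs_add_le _ _).trans_eq (by rw [abs_mul, abs_mul])
        _ ≤ H * ‖x + h • e - x‖ ^ α * M + m * (L * ‖x + h • e - x‖) := by
            gcongr
            · exact hφM _
            · exact hfm x hx1
        _ ≤ H * h ^ α * M + m * (L * (h₀ ^ (1 - α) * h ^ α)) := by
            have hα0 := hα.1.le
            have h3 : h ≤ h₀ ^ (1 - α) * h ^ α := by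
              calc h = h ^ (1 - α) * h ^ α := by
                    rw [← Real.rpow_add hh0, sub_add_cancel, Real.rpow_one]
                _ ≤ _ := by
                    have : 0 ≤ 1 - α := by linarith [hα.2]
                    gcongr
                    exact hh.2
            have h4 := hstep.trans h3
            gcongr
        _ = _ := by ring
    · rw [not_or] at hx
      rw [hφK _ hx.1, hφK _ hx.2, mul_zero, mul_zero, sub_zero, abs_zero]
      positivity
  aesm := hA
  bdd := hAb
  incr_right := by
    intro h hh x hx
    have hh0 := hh.1
    have hβ0 := hβ.1.le
    have hx1 : x ∈ S := hS (mem_cthickening_of_mem_or he hh.1.le (by linarith [hh.2]) hx)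
    have hx2 : x - h • e ∈ S := by
      have hth : ∀ y ∈ K, ∀ c : ℝ, x - h • e = y - c • e → |c| ≤ 2 * h₀ → x - h • e ∈ S := by
        intro y hy c hxy hc
        refine hS (Metric.mem_cthickening_of_dist_le _ y _ K hy ?_)
        rw [hxy, dist_eq_norm, sub_sub_cancel_left, norm_neg, norm_smul, Real.norm_eq_abs]
        nlinarith [norm_nonneg e, abs_nonneg c]
      rcases hx with hx | hx
      · exact hth x hx h rfl (by rw [abs_of_pos hh0]; linarith [hh.2])
      · refine hth _ hx (2 * h) ?_ (by rw [abs_of_pos (by linarith)]; linarith [hh.2])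
        rw [two_mul, add_smul]; abel
    refine (hAS x hx1 _ hx2).trans ?_
    have : ‖x - (x - h • e)‖ ≤ h := by
      rw [sub_sub_cancel, norm_smul, Real.norm_of_nonneg hh0.le]
      nlinarith
    gcongr

lemma tendsto_diffPairing_of_uniform {K : Set E} (hK : IsCompact K) {e : E} (he : ‖e‖ ≤ 1) {h B : ℝ}
    (hh : 0 < h) {ψ : ℕ → E → ℝ} {ψ₀ A : E → ℝ} (hψ : ∀ ν, Continuous (ψ ν))
    (hψ₀ : Continuous ψ₀) (hψK : ∀ ν, ∀ x ∉ K, ψ ν x = 0) (hψ₀K : ∀ x ∉ K, ψ₀ x = 0)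
    {δ : ℕ → ℝ} (hδ : Tendsto δ atTop (𝓝 0)) (hψδ : ∀ ν x, |ψ ν x - ψ₀ x| ≤ δ ν)
    (hA : AEStronglyMeasurable A volume) (hB : ∀ x, |A x| ≤ B) :
    Tendsto (fun ν ↦ diffPairing e (ψ ν) A h) atTop (𝓝 (diffPairing e ψ₀ A h)) := by
  rw [tendsto_iff_norm_sub_tendsto_zero]
  set V := volume.real (Metric.cthickening h K)
  have hlim : Tendsto (fun ν ↦ (δ ν + δ ν) / h * B * V) atTop (𝓝 0) := by
    simpa using (((hδ.add hδ).div_const h).mul_const B).mul_const V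
  have hB0 : 0 ≤ B := (abs_nonneg _).trans (hB 0)
  refine squeeze_zero (fun _ ↦ norm_nonneg _) (fun ν ↦ ?_) hlim
  have hint : ∀ {ψ : E → ℝ}, Continuous ψ → (∀ x ∉ K, ψ x = 0) →
      Integrable (fun x ↦ (ψ (x + h • e) - ψ x) / h * A x) := fun hc h0 ↦ by
    simpa using integrable_diff_mul hc (HasCompactSupport.intro hK h0) hA hB (h • e) 0 h
  have hδ0 : 0 ≤ δ ν := (abs_nonneg _).trans (hψδ ν 0)
  rw [diffPairing, diffPairing, ← integral_sub (hint (hψ ν) (hψK ν)) (hint hψ₀ hψ₀K)]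
  refine abs_integral_le_of_eq_zero_off hK he hh.le le_rfl (by positivity) ?_ ?_
  · intro x hx
    rw [not_or] at hx
    simp [hψK ν _ hx.1, hψK ν _ hx.2, hψ₀K _ hx.1, hψ₀K _ hx.2]
  · intro x _
    have h1 := hψδ ν (x + h • e)
    have h2 := hψδ ν x
    calc |(ψ ν (x + h • e) - ψ ν x) / h * A x - (ψ₀ (x + h • e) - ψ₀ x) / h * A x|
        = |(ψ ν (x + h • e) - ψ₀ (x + h • e)) - (ψ ν x - ψ₀ x)| / h * |A x| := by
          rw [← abs_of_pos hh, ← abs_div, ← abs_mul, abs_of_pos hh]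
          congr 1
          ring
      _ ≤ _ := by
          gcongr
          · exact (abs_sub _ _).trans (add_le_add h1 h2)
          · exact hB x

end Young

section Product

variable {n : ℕ}

/-! ### The distributional product as a limit of difference quotients -/

lemma partialDeriv_toDistribution_apply {Ω : Opens (EuclideanSpace ℝ (Fin n))} {i : Fin n}
    {A : EuclideanSpace ℝ (Fin n) → ℝ} (hA : ContinuousOn A Ω) (φ : 𝓓(Ω, ℝ)) :
    partialDeriv i (toDistribution Ω A) φ = -∫ x, fderiv ℝ φ x (EuclideanSpace.single i 1) *
      (Ω : Set (EuclideanSpace ℝ (Fin n))).indicator A x := by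
  rw [partialDeriv, Distribution.lineDerivOp_apply_apply,
    toDistribution_apply (hA.locallyIntegrableOn Ω.isOpen.measurableSet), ← integral_neg]
  congr 1 with x
  have h1 : (-∂_{EuclideanSpace.single i (1 : ℝ)} φ : 𝓓(Ω, ℝ)) x =
      -(fderiv ℝ φ x (EuclideanSpace.single i 1)) := by
    have h2 : (∂_{EuclideanSpace.single i (1 : ℝ)} φ : 𝓓(Ω, ℝ)) x =
        fderiv ℝ φ x (EuclideanSpace.single i 1) := by
      rw [TestFunction.lineDerivOp_eq_lineDerivCLM ℝ, TestFunction.lineDerivCLM_apply,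
        if_pos (by simp)]
      exact (φ.contDiff.differentiable (by simp) x).lineDeriv_eq_fderiv
    rw [← h2]
    rfl
  rw [h1, neg_mul]
  by_cases hx : x ∈ Ω
  · rw [indicator_of_mem hx]
  · have : fderiv ℝ φ x = 0 := by
      have h3 : x ∉ tsupport φ := fun h ↦ hx (φ.tsupport_subset h)
      exact image_eq_zero_of_notMem_tsupport fun h ↦ h3 (tsupport_fderiv_subset ℝ h)
    simp [this]

lemma integral_fderiv_apply_eq_sum {V : Set (EuclideanSpace ℝ (Fin n))}
    {ψ : EuclideanSpace ℝ (Fin n) → ℝ} (hψ : ContDiff ℝ 1 ψ) (hψc : HasCompactSupport ψ)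
    (hψV : tsupport ψ ⊆ V) {A : EuclideanSpace ℝ (Fin n) → EuclideanSpace ℝ (Fin n)}
    (hA : ∀ i, AEStronglyMeasurable (V.indicator fun x ↦ A x i) volume) {B : ℝ}
    (hB : ∀ i x, |V.indicator (fun x ↦ A x i) x| ≤ B) :
    ∫ x, fderiv ℝ ψ x (A x) = ∑ i, ∫ x, fderiv ℝ ψ x (EuclideanSpace.single i 1) *
      V.indicator (fun x ↦ A x i) x := by
  rw [← integral_finsetSum]
  · congr 1 with x
    by_cases hx : x ∈ V
    · conv_lhs => rw [← (EuclideanSpace.basisFun (Fin n) ℝ).sum_repr (A x)]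
      simp [indicator_of_mem hx, mul_comm]
    · have : fderiv ℝ ψ x = 0 :=
        image_eq_zero_of_notMem_tsupport fun h ↦ hx (hψV (tsupport_fderiv_subset ℝ h))
      simp [this]
  · intro i _
    refine integrable_mul_bounded ?_ ?_ (hA i) (hB i)
    · exact (hψ.continuous_fderiv (by norm_num)).clm_apply continuous_const
    · exact hψc.fderiv_apply ℝ _

/-- The product of a function `f` and the derivative of a function `A`, both Hölder continuous of
every order less than one, is independent of the approximating sequences: it is the limit of the
difference quotient pairings. The limits in the sequence and in the step can be exchanged because
the bounds of `YoungPair.abs_diffPairing_sub_le_of_tendsto` are uniform along the sequence. -/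
lemma IsProduct.tendsto_diffPairing {Ω : Opens (EuclideanSpace ℝ (Fin n))}
    {f A : EuclideanSpace ℝ (Fin n) → ℝ} {i : Fin n} {T : 𝓓'(Ω, ℝ)}
    (hf : ∀ α ∈ Ioo (0 : ℝ) 1, ∃ C, 0 ≤ C ∧
      HolderBound (Ω : Set (EuclideanSpace ℝ (Fin n))) α f C)
    (hA : ∀ α ∈ Ioo (0 : ℝ) 1, ∃ C, 0 ≤ C ∧
      HolderBound (Ω : Set (EuclideanSpace ℝ (Fin n))) α A C)
    (h : IsProduct Ω f (partialDeriv i (toDistribution Ω A)) T) (φ : 𝓓(Ω, ℝ))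
    {K : Set (EuclideanSpace ℝ (Fin n))} (hK : IsCompact K) (hφK : tsupport φ ⊆ K) {h₀ : ℝ}
    (hh₀ : 0 < h₀) (hKΩ : Metric.cthickening (3 * h₀) K ⊆ Ω) :
    Tendsto (fun k : ℕ ↦ diffPairing (EuclideanSpace.single i 1) (fun x ↦ f x * φ x)
      ((Ω : Set (EuclideanSpace ℝ (Fin n))).indicator A) (h₀ / 2 ^ k)) atTop (𝓝 (-T φ)) := by
  obtain ⟨α, hα, β, hβ, hαβ, F, g, hF, -, hFf, hgG, hT⟩ := h
  obtain ⟨Cf, hCf0, hCf⟩ := hf α hα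
  obtain ⟨CA, hCA0, hCA⟩ := hA β hβ
  set e : EuclideanSpace ℝ (Fin n) := EuclideanSpace.single i 1 with he_def
  have he : ‖e‖ ≤ 1 := by simp [he_def]
  let V : Opens (EuclideanSpace ℝ (Fin n)) := ⟨Metric.thickening (3 * h₀) K,
    Metric.isOpen_thickening⟩
  have hVΩ : (V : Set (EuclideanSpace ℝ (Fin n))) ⊆ Ω :=
    (Metric.thickening_subset_cthickening _ _).trans hKΩ
  have hVc : CompactlyInside V Ω :=
    ⟨hK.cthickening.of_isClosed_subset isClosed_closure
      (Metric.closure_thickening_subset_cthickening _ _),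
      (Metric.closure_thickening_subset_cthickening _ _).trans hKΩ⟩
  have hKV : Metric.cthickening (2 * h₀) K ⊆ V :=
    Metric.cthickening_subset_thickening' (by linarith) (by linarith) K
  have hKV0 : K ⊆ V := (Metric.self_subset_cthickening K).trans hKV
  obtain ⟨εF, hεF, hFb⟩ := hFf V hVc
  obtain ⟨a, Av, εA, hεA, hab, hAb, hdecomp⟩ := hgG V hVc
  obtain ⟨BF, hBF⟩ : ∃ B, ∀ ν, |εF ν| ≤ B := by
    obtain ⟨B, hB⟩ := hεF.abs.bddAbove_range
    exact ⟨B, fun ν ↦ hB ⟨ν, rfl⟩⟩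
  have hBF0 : 0 ≤ BF := (abs_nonneg _).trans (hBF 0)
  set m := Cf + BF with hm_def
  have hm : 0 ≤ m := by positivity
  obtain ⟨M, hM⟩ := φ.continuous.bounded_above_of_compact_support φ.hasCompactSupport
  have hM0 : 0 ≤ M := (norm_nonneg _).trans (hM 0)
  obtain ⟨L, hL⟩ := ContDiff.lipschitzWith_of_hasCompactSupport φ.hasCompactSupport φ.contDiff
    (by simp)
  have hφL : ∀ x y, |φ x - φ y| ≤ L * ‖x - y‖ := fun x y ↦ hL.norm_sub_le x y
  have hφ0 : ∀ x ∉ K, φ x = 0 := fun x hx ↦ image_eq_zero_of_notMem_tsupport fun h ↦ hx (hφK h)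
  have hFV : ∀ ν, HolderBound (V : Set (EuclideanSpace ℝ (Fin n))) α (F ν) m := fun ν ↦ by
    have := ((hFb ν).mono_const ((le_abs_self _).trans (hBF ν))).add (hCf.mono hVΩ)
    rw [sub_add_cancel, add_comm] at this
    exact this
  -- the test functions `F ν * φ`
  have hψs : ∀ ν, ContDiff ℝ ∞ (fun x ↦ F ν x * φ x) := fun ν ↦
    contDiff_mul_of_tsupport_subset Ω.isOpen (hF ν) φ.contDiff φ.tsupport_subset
  have hψt : ∀ ν, tsupport (fun x ↦ F ν x * φ x) ⊆ tsupport φ := fun ν ↦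
    tsupport_smul_subset_right (F ν) φ
  let ψ : ℕ → 𝓓(Ω, ℝ) := fun ν ↦ ⟨fun x ↦ F ν x * φ x, hψs ν,
    φ.hasCompactSupport.of_isClosed_subset (isClosed_tsupport _) (hψt ν),
    (hψt ν).trans φ.tsupport_subset⟩
  have hψ_apply : ∀ ν x, ψ ν x = F ν x * φ x := fun _ _ ↦ rfl
  have hψ1 : ∀ ν, ContDiff ℝ 1 (ψ ν) := fun ν ↦ (ψ ν).contDiff.of_le (by simp)
  have hψV : ∀ ν, tsupport (ψ ν) ⊆ V := fun ν ↦ (hψt ν).trans (hφK.trans hKV0)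
  have hfc : ContinuousOn f Ω := hCf.continuousOn hα.1
  have hAc : ContinuousOn A Ω := hCA.continuousOn hβ.1
  set A' := (Ω : Set (EuclideanSpace ℝ (Fin n))).indicator A with hA'
  have hA'm : AEStronglyMeasurable A' volume := aestronglyMeasurable_indicator Ω.isOpen hAc
  have hA'b : ∀ x, |A' x| ≤ CA := fun x ↦ by
    by_cases hx : x ∈ (Ω : Set (EuclideanSpace ℝ (Fin n)))
    · rw [hA', indicator_of_mem hx]; exact hCA.1 x hx
    · rw [hA', indicator_of_notMem hx, abs_zero]; exact hCA0
  have hA'V : ∀ x ∈ (V : Set (EuclideanSpace ℝ (Fin n))), ∀ y ∈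
      (V : Set (EuclideanSpace ℝ (Fin n))), |A' x - A' y| ≤ CA * ‖x - y‖ ^ β := by
    intro x hx y hy
    rw [hA', indicator_of_mem (hVΩ hx), indicator_of_mem (hVΩ hy)]
    exact hCA.2 x (hVΩ hx) y (hVΩ hy)
  set c := m * M + m * (L * h₀ ^ (1 - α)) with hc
  have hP : ∀ ν, YoungPair K e h₀ α β c CA (ψ ν) A' := fun ν ↦
    YoungPair.of_mul hK he hh₀ hα hβ hKV hm hm hM0 L.2 (hFV ν).1 (hFV ν).2 hM hφL hφ0
      (hψs ν).continuous hA'm ⟨CA, hA'b⟩ hCA0 hA'V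
  have hI : ∀ ν, Tendsto (fun k : ℕ ↦ diffPairing e (ψ ν) A' (h₀ / 2 ^ k)) atTop
      (𝓝 (∫ x, fderiv ℝ (ψ ν) x e * A' x)) := fun ν ↦
    LogLipFlow.tendsto_diffPairing hh₀ he (hψ1 ν) (ψ ν).hasCompactSupport hA'm hA'b
  -- for a fixed step, the pairings converge along the sequence
  have hJ : ∀ k : ℕ, Tendsto (fun ν ↦ diffPairing e (ψ ν) A' (h₀ / 2 ^ k)) atTop
      (𝓝 (diffPairing e (fun x ↦ f x * φ x) A' (h₀ / 2 ^ k))) := by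
    intro k
    refine tendsto_diffPairing_of_uniform (ψ := fun ν ↦ ψ ν) (δ := fun ν ↦ |εF ν| * M) hK he
      (by positivity) (fun ν ↦ (ψ ν).continuous)
      (continuous_mul_of_tsupport_subset Ω.isOpen hfc φ.continuous φ.tsupport_subset)
      (fun ν x hx ↦ by rw [hψ_apply, hφ0 x hx, mul_zero]) (fun x hx ↦ by rw [hφ0 x hx, mul_zero])
      (by simpa using hεF.abs.mul_const M) ?_ hA'm hA'b
    intro ν x
    rw [hψ_apply, ← sub_mul, abs_mul]
    by_cases hx : x ∈ K
    · exact mul_le_mul (((hFb ν).1 x (hKV0 hx)).trans (le_abs_self _)) (hM x) (abs_nonneg _)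
        (abs_nonneg _)
    · rw [hφ0 x hx, abs_zero, mul_zero]; positivity
  -- the remainder terms tend to zero
  have hψm : ∀ ν x, |ψ ν x| ≤ m * M := fun ν x ↦ by
    by_cases hx : x ∈ K
    · rw [hψ_apply, abs_mul]
      gcongr
      · exact (hFV ν).1 x (hKV0 hx)
      · exact hM x
    · rw [hψ_apply, hφ0 x hx, mul_zero, abs_zero]; positivity
  have hrem1 : Tendsto (fun ν ↦ ∫ x, a ν x * ψ ν x) atTop (𝓝 0) := by
    have hlim : Tendsto (fun ν ↦ |εA ν| * (m * M) * volume.real (Metric.cthickening h₀ K)) atTop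
        (𝓝 0) := by
      simpa using (hεA.abs.mul_const (m * M)).mul_const (volume.real (Metric.cthickening h₀ K))
    refine squeeze_zero_norm (fun ν ↦ ?_) hlim
    refine abs_integral_le_of_eq_zero_off (e := 0) hK (by simp) hh₀.le le_rfl (by positivity) ?_ ?_
    · intro x hx
      rw [not_or] at hx
      rw [hψ_apply, hφ0 x hx.1, mul_zero, mul_zero]
    · intro x hx
      simp only [smul_zero, add_zero, or_self] at hx
      rw [abs_mul]
      exact mul_le_mul (((hab ν).1 x (hKV0 hx)).trans (le_abs_self _)) (hψm ν x) (abs_nonneg _)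
        (abs_nonneg _)
  have hBc : ∀ ν j, ContinuousOn (fun x ↦ Av ν x j) V := fun ν j ↦
    ((hAb ν).apply j).continuousOn hβ.1
  have hBm : ∀ ν j, AEStronglyMeasurable ((V : Set (EuclideanSpace ℝ (Fin n))).indicator
      fun x ↦ Av ν x j) volume := fun ν j ↦ aestronglyMeasurable_indicator V.isOpen (hBc ν j)
  have hBb : ∀ ν j x, |(V : Set (EuclideanSpace ℝ (Fin n))).indicator (fun x ↦ Av ν x j) x| ≤
      |εA ν| := fun ν j x ↦ by
    by_cases hx : x ∈ (V : Set (EuclideanSpace ℝ (Fin n)))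
    · rw [indicator_of_mem hx]; exact (((hAb ν).apply j).1 x hx).trans (le_abs_self _)
    · rw [indicator_of_notMem hx, abs_zero]; positivity
  have hrem2 : Tendsto (fun ν ↦ ∫ x, fderiv ℝ (ψ ν) x (Av ν x)) atTop (𝓝 0) := by
    have heq : ∀ ν, ∫ x, fderiv ℝ (ψ ν) x (Av ν x) = ∑ j, ∫ x, fderiv ℝ (ψ ν) x
        (EuclideanSpace.single j 1) * (V : Set (EuclideanSpace ℝ (Fin n))).indicator
          (fun x ↦ Av ν x j) x := fun ν ↦
      integral_fderiv_apply_eq_sum (hψ1 ν) (ψ ν).hasCompactSupport (hψV ν) (hBm ν) (hBb ν)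
    simp only [heq]
    rw [← Finset.sum_const_zero (s := (Finset.univ : Finset (Fin n)))]
    refine tendsto_finsetSum _ fun j _ ↦ ?_
    set k1 := h₀ ^ (α + β - 1) / (1 - (1 / 2) ^ (α + β - 1))
    set k2 := h₀ ^ α / h₀
    set vol := volume.real (Metric.cthickening h₀ K)
    have hlim : Tendsto (fun ν ↦ c * (|εA ν| * k1 + |εA ν| * k2) * vol) atTop (𝓝 0) := by
      simpa using (((hεA.abs.mul_const k1).add (hεA.abs.mul_const k2)).const_mul c).mul_const vol
    refine squeeze_zero_norm (fun ν ↦ ?_) hlim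
    have hQ : YoungPair K (EuclideanSpace.single j 1) h₀ α β c |εA ν| (ψ ν)
        ((V : Set (EuclideanSpace ℝ (Fin n))).indicator fun x ↦ Av ν x j) :=
      YoungPair.of_mul hK (by simp) hh₀ hα hβ hKV hm hm hM0 L.2 (hFV ν).1 (hFV ν).2 hM hφL hφ0
        (hψs ν).continuous (hBm ν j) ⟨_, hBb ν j⟩ (abs_nonneg _) (fun x hx y hy ↦ by
          rw [indicator_of_mem hx, indicator_of_mem hy]
          exact ((hAb ν).apply j).mono_const (le_abs_self _) |>.2 x hx y hy)
    exact hQ.abs_integral_fderiv_mul_le hαβ (hψ1 ν) (abs_nonneg _) (hBb ν j)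
  have hIT : Tendsto (fun ν ↦ ∫ x, fderiv ℝ (ψ ν) x e * A' x) atTop (𝓝 (-T φ)) := by
    have hlim := ((hT φ).neg.add hrem1).sub hrem2
    rw [add_zero, sub_zero] at hlim
    refine hlim.congr fun ν ↦ ?_
    have h1 := hdecomp ν (ψ ν) (hψV ν)
    rw [partialDeriv_toDistribution_apply hAc] at h1
    have h2 : ∫ x, F ν x * g ν x * φ x = ∫ x, g ν x * ψ ν x := by
      congr 1 with x
      rw [hψ_apply]; ring
    rw [h2]
    linarith
  set r : ℝ := (1 / 2) ^ (α + β - 1) with hr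
  have hr0 : 0 ≤ r := by positivity
  have hr1 : r < 1 := Real.rpow_lt_one (by norm_num) (by norm_num) (by linarith)
  set D := c * CA * h₀ ^ (α + β - 1) * volume.real (Metric.cthickening h₀ K) with hD
  have hkey : ∀ k : ℕ, |diffPairing e (fun x ↦ f x * φ x) A' (h₀ / 2 ^ k) - -T φ| ≤
      D * r ^ k / (1 - r) := fun k ↦
    le_of_tendsto ((hJ k).sub hIT).abs (Eventually.of_forall fun ν ↦
      (hP ν).abs_diffPairing_sub_le_of_tendsto hαβ (hI ν) k)
  rw [tendsto_iff_norm_sub_tendsto_zero]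
  refine squeeze_zero (fun _ ↦ norm_nonneg _) hkey ?_
  simpa using ((tendsto_pow_atTop_nhds_zero_of_lt_one hr0 hr1).const_mul D).div_const (1 - r)

end Product

section Mollifier

variable {n : ℕ}

/-! ### Mollification -/

variable (n) in
/-- A smooth bump function of integral one, supported in the unit ball. -/
noncomputable def unitBump : EuclideanSpace ℝ (Fin n) → ℝ :=
  (⟨1 / 2, 1, by norm_num, by norm_num⟩ : ContDiffBump (0 : EuclideanSpace ℝ (Fin n))).normed volume

/-- The rescaled bump function `ε⁻ⁿ ρ(z / ε)`. -/
noncomputable def mollKernel (ε : ℝ) (z : EuclideanSpace ℝ (Fin n)) : ℝ :=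
  (ε ^ n)⁻¹ * unitBump n (ε⁻¹ • z)

lemma contDiff_mollKernel (ε : ℝ) : ContDiff ℝ ∞ (mollKernel (n := n) ε) :=
  contDiff_const.mul ((ContDiffBump.contDiff_normed _).comp (contDiff_const_smul _))

lemma mollKernel_nonneg {ε : ℝ} (hε : 0 < ε) (z : EuclideanSpace ℝ (Fin n)) :
    0 ≤ mollKernel ε z :=
  mul_nonneg (by positivity) (ContDiffBump.nonneg_normed _ _)

lemma mollKernel_eq_zero {ε : ℝ} (hε : 0 < ε) {z : EuclideanSpace ℝ (Fin n)} (hz : ε < ‖z‖) :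
    mollKernel ε z = 0 := by
  have : unitBump n (ε⁻¹ • z) = 0 := by
    rw [← Function.notMem_support, unitBump, ContDiffBump.support_normed_eq, mem_ball_zero_iff,
      not_lt, norm_smul, norm_inv, Real.norm_of_nonneg hε.le]
    simp only
    rw [inv_mul_eq_div, one_le_div hε]
    exact hz.le
  rw [mollKernel, this, mul_zero]

lemma hasCompactSupport_mollKernel {ε : ℝ} (hε : 0 < ε) :
    HasCompactSupport (mollKernel (n := n) ε) :=
  HasCompactSupport.intro (isCompact_closedBall 0 ε) fun z hz ↦
    mollKernel_eq_zero hε (by simpa using hz)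

lemma integral_mollKernel {ε : ℝ} (hε : 0 < ε) :
    ∫ z : EuclideanSpace ℝ (Fin n), mollKernel ε z = 1 := by
  simp only [mollKernel]
  rw [integral_const_mul, Measure.integral_comp_inv_smul, finrank_euclideanSpace_fin, unitBump,
    ContDiffBump.integral_normed, smul_eq_mul, mul_one, abs_of_pos (by positivity),
    inv_mul_cancel₀ (by positivity)]

variable (n) in
lemma exists_unitBump_bound : ∃ M : ℝ, 0 ≤ M ∧ (∀ z, |unitBump n z| ≤ M) ∧
    ∀ z w, |unitBump n z - unitBump n w| ≤ M * ‖z - w‖ := by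
  have h1 : ContDiff ℝ 1 (unitBump n) := ContDiffBump.contDiff_normed (n := 1) _
  have h2 : HasCompactSupport (unitBump n) := ContDiffBump.hasCompactSupport_normed _
  obtain ⟨M, hM⟩ := h1.continuous.bounded_above_of_compact_support h2
  obtain ⟨L, hL⟩ := ContDiff.lipschitzWith_of_hasCompactSupport h2 h1 (by norm_num)
  refine ⟨max M L, le_max_of_le_right L.2, fun z ↦ (hM z).trans (le_max_left _ _),
    fun z w ↦ (hL.norm_sub_le z w).trans ?_⟩
  gcongr
  exact le_max_right _ _

variable (n) in
/-- A common bound for the unit bump function and its Lipschitz constant. -/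
noncomputable def bumpBound : ℝ := (exists_unitBump_bound n).choose

variable (n) in
lemma bumpBound_nonneg : 0 ≤ bumpBound n := (exists_unitBump_bound n).choose_spec.1

lemma abs_mollKernel_le {ε : ℝ} (hε : 0 < ε) (z : EuclideanSpace ℝ (Fin n)) :
    |mollKernel ε z| ≤ bumpBound n * (ε ^ n)⁻¹ := by
  rw [mollKernel, abs_mul, abs_of_pos (by positivity), mul_comm]
  gcongr
  exact (exists_unitBump_bound n).choose_spec.2.1 _

lemma abs_mollKernel_sub_le {ε : ℝ} (hε : 0 < ε) (z w : EuclideanSpace ℝ (Fin n)) :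
    |mollKernel ε z - mollKernel ε w| ≤ bumpBound n * (ε ^ n)⁻¹ * ε⁻¹ * ‖z - w‖ := by
  rw [mollKernel, mollKernel, ← mul_sub, abs_mul, abs_of_pos (by positivity)]
  have h1 := (exists_unitBump_bound n).choose_spec.2.2 (ε⁻¹ • z) (ε⁻¹ • w)
  rw [← smul_sub, norm_smul, norm_inv, Real.norm_of_nonneg hε.le] at h1
  calc _ ≤ (ε ^ n)⁻¹ * (bumpBound n * (ε⁻¹ * ‖z - w‖)) := by gcongr; exact h1
    _ = _ := by ring

/-- The mollification of `f` at scale `ε`. -/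
noncomputable def moll {F : Type*} [NormedAddCommGroup F] [NormedSpace ℝ F] (ε : ℝ)
    (f : EuclideanSpace ℝ (Fin n) → F) (x : EuclideanSpace ℝ (Fin n)) : F :=
  ∫ y, mollKernel ε (x - y) • f y

variable {F : Type*} [NormedAddCommGroup F] [NormedSpace ℝ F]

lemma contDiff_moll {ε : ℝ} (hε : 0 < ε) {f : EuclideanSpace ℝ (Fin n) → F}
    (hf : AEStronglyMeasurable f volume) {B : ℝ} (hB : ∀ x, ‖f x‖ ≤ B) :
    ContDiff ℝ ∞ (moll ε f) := by
  have h1 : moll ε f = convolution (mollKernel ε) f (ContinuousLinearMap.lsmul ℝ ℝ) volume := by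
    ext1 x
    rw [convolution_eq_swap]
    rfl
  rw [h1]
  exact (hasCompactSupport_mollKernel hε).contDiff_convolution_left _ (contDiff_mollKernel ε)
    ((memLp_top_of_bound hf B (Eventually.of_forall hB)).locallyIntegrable le_top)

lemma continuous_mollKernel_sub (ε : ℝ) (x : EuclideanSpace ℝ (Fin n)) :
    Continuous fun y ↦ mollKernel ε (x - y) :=
  (contDiff_mollKernel ε).continuous.comp (continuous_const.sub continuous_id)

lemma mollKernel_sub_eq_zero {ε : ℝ} (hε : 0 < ε) {x y : EuclideanSpace ℝ (Fin n)}
    (hy : y ∉ Metric.closedBall x ε) : mollKernel ε (x - y) = 0 :=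
  mollKernel_eq_zero hε (by rwa [← dist_eq_norm, dist_comm, ← not_le, ← Metric.mem_closedBall])

lemma hasCompactSupport_mollKernel_sub {ε : ℝ} (hε : 0 < ε) (x : EuclideanSpace ℝ (Fin n)) :
    HasCompactSupport fun y ↦ mollKernel ε (x - y) :=
  HasCompactSupport.intro (isCompact_closedBall x ε) fun _ hy ↦ mollKernel_sub_eq_zero hε hy

lemma integrable_mollKernel_sub {ε : ℝ} (hε : 0 < ε) (x : EuclideanSpace ℝ (Fin n)) :
    Integrable fun y ↦ mollKernel ε (x - y) :=
  (continuous_mollKernel_sub ε x).integrable_of_hasCompactSupport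
    (hasCompactSupport_mollKernel_sub hε x)

lemma integral_mollKernel_sub {ε : ℝ} (hε : 0 < ε) (x : EuclideanSpace ℝ (Fin n)) :
    ∫ y, mollKernel ε (x - y) = 1 := by
  rw [integral_sub_left_eq_self (mollKernel ε), integral_mollKernel hε]

lemma integrable_mollKernel_smul {ε : ℝ} (hε : 0 < ε) {f : EuclideanSpace ℝ (Fin n) → F}
    (hf : AEStronglyMeasurable f volume) {B : ℝ} (hB : ∀ x, ‖f x‖ ≤ B)
    (x : EuclideanSpace ℝ (Fin n)) : Integrable fun y ↦ mollKernel ε (x - y) • f y :=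
  (integrable_mollKernel_sub hε x).smul_bdd B hf (Eventually.of_forall hB)

lemma moll_sub_const [CompleteSpace F] {ε : ℝ} (hε : 0 < ε) {f : EuclideanSpace ℝ (Fin n) → F}
    (hf : AEStronglyMeasurable f volume) {B : ℝ} (hB : ∀ x, ‖f x‖ ≤ B) (c : F)
    (x : EuclideanSpace ℝ (Fin n)) :
    moll ε f x - c = ∫ y, mollKernel ε (x - y) • (f y - c) := by
  simp only [smul_sub]
  rw [integral_sub (integrable_mollKernel_smul hε hf hB x)
    ((integrable_mollKernel_sub hε x).smul_const c), integral_smul_const,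
    integral_mollKernel_sub hε, one_smul, moll]

lemma norm_moll_sub_le [CompleteSpace F] {ε : ℝ} (hε : 0 < ε) {f : EuclideanSpace ℝ (Fin n) → F}
    (hf : AEStronglyMeasurable f volume) {B : ℝ} (hB : ∀ x, ‖f x‖ ≤ B) {c : F} {d : ℝ}
    {x : EuclideanSpace ℝ (Fin n)} (hd : ∀ y ∈ Metric.closedBall x ε, ‖f y - c‖ ≤ d) :
    ‖moll ε f x - c‖ ≤ d := by
  rw [moll_sub_const hε hf hB]
  calc _ ≤ ∫ y, mollKernel ε (x - y) * d := by
        refine norm_integral_le_of_norm_le ((integrable_mollKernel_sub hε x).mul_const d)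
          (Eventually.of_forall fun y ↦ ?_)
        rw [norm_smul, Real.norm_of_nonneg (mollKernel_nonneg hε _)]
        by_cases hy : y ∈ Metric.closedBall x ε
        · gcongr
          · exact mollKernel_nonneg hε _
          · exact hd y hy
        · rw [mollKernel_sub_eq_zero hε hy, zero_mul, zero_mul]
    _ = d := by rw [integral_mul_const, integral_mollKernel_sub hε, one_mul]

lemma norm_moll_le [CompleteSpace F] {ε : ℝ} (hε : 0 < ε) {f : EuclideanSpace ℝ (Fin n) → F}
    (hf : AEStronglyMeasurable f volume) {B : ℝ} (hB : ∀ x, ‖f x‖ ≤ B)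
    (x : EuclideanSpace ℝ (Fin n)) : ‖moll ε f x‖ ≤ B := by
  simpa using norm_moll_sub_le (c := 0) hε hf hB (x := x) (fun y _ ↦ by simpa using hB y)

variable (n) in
/-- The volume of the unit ball. -/
noncomputable def ballVol : ℝ :=
  (volume : Measure (EuclideanSpace ℝ (Fin n))).real (Metric.ball 0 1)

lemma volume_real_closedBall (x : EuclideanSpace ℝ (Fin n)) {r : ℝ} (hr : 0 ≤ r) :
    (volume : Measure (EuclideanSpace ℝ (Fin n))).real (Metric.closedBall x r) =
      r ^ n * ballVol n := by
  rw [Measure.addHaar_real_closedBall _ _ hr, finrank_euclideanSpace_fin, ballVol]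

/-- The derivative of the mollification at scale `ε` is controlled by the oscillation of `f` at
that scale, divided by `ε`. -/
lemma norm_fderiv_moll_le [CompleteSpace F] {ε : ℝ} (hε : 0 < ε)
    {f : EuclideanSpace ℝ (Fin n) → F} (hf : AEStronglyMeasurable f volume) {B : ℝ}
    (hB : ∀ x, ‖f x‖ ≤ B) {c : F} {d : ℝ} {x : EuclideanSpace ℝ (Fin n)} (hd0 : 0 ≤ d)
    (hd : ∀ y ∈ Metric.closedBall x (2 * ε), ‖f y - c‖ ≤ d) :
    ‖fderiv ℝ (moll ε f) x‖ ≤ bumpBound n * 2 ^ n * ballVol n * (d / ε) := by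
  have hb := bumpBound_nonneg n
  have hv : 0 ≤ ballVol n := measureReal_nonneg
  refine norm_fderiv_le_of_lip' ℝ (by positivity) ?_
  filter_upwards [Metric.closedBall_mem_nhds x hε] with x' hx'
  have hint : ∀ z, Integrable fun y ↦ mollKernel ε (z - y) • (f y - c) := fun z ↦ by
    simp only [smul_sub]
    exact (integrable_mollKernel_smul hε hf hB z).sub ((integrable_mollKernel_sub hε z).smul_const c)
  have hsub : Metric.closedBall x' ε ⊆ Metric.closedBall x (2 * ε) :=
    Metric.closedBall_subset_closedBall' (by linarith [Metric.mem_closedBall.1 hx'])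
  have h1 : moll ε f x' - moll ε f x =
      ∫ y in Metric.closedBall x (2 * ε),
        (mollKernel ε (x' - y) - mollKernel ε (x - y)) • (f y - c) := by
    rw [setIntegral_eq_integral_of_forall_compl_eq_zero]
    · simp only [sub_smul]
      rw [integral_sub (hint x') (hint x), ← moll_sub_const hε hf hB, ← moll_sub_const hε hf hB]
      abel
    · intro y hy
      rw [mollKernel_sub_eq_zero hε fun h ↦ hy (hsub h), mollKernel_sub_eq_zero hε fun h ↦
        hy (Metric.closedBall_subset_closedBall (by linarith) h), sub_self, zero_smul]
  rw [h1]
  refine (norm_setIntegral_le_of_norm_le_const (C := bumpBound n * (ε ^ n)⁻¹ * ε⁻¹ * ‖x' - x‖ * d)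
    (isCompact_closedBall x (2 * ε)).measure_lt_top fun y hy ↦ ?_).trans (le_of_eq ?_)
  · rw [norm_smul]
    gcongr
    · have := abs_mollKernel_sub_le hε (x' - y) (x - y)
      rwa [sub_sub_sub_cancel_right] at this
    · exact hd y hy
  · rw [volume_real_closedBall _ (by positivity), mul_pow]
    field_simp

/-- The difference quotient pairing with the mollifying kernel is a difference quotient of the
mollification. -/
lemma tendsto_diffPairing_mollKernel {ε : ℝ} (hε : 0 < ε) {A : EuclideanSpace ℝ (Fin n) → ℝ}
    (hA : AEStronglyMeasurable A volume) {B : ℝ} (hB : ∀ x, |A x| ≤ B)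
    (x e : EuclideanSpace ℝ (Fin n)) {h₀ : ℝ} (hh₀ : 0 < h₀) :
    Tendsto (fun k : ℕ ↦ diffPairing e (fun y ↦ mollKernel ε (x - y)) A (h₀ / 2 ^ k)) atTop
      (𝓝 (-fderiv ℝ (moll ε A) x e)) := by
  have hd : DifferentiableAt ℝ (moll ε A) x :=
    (contDiff_moll hε hA hB).differentiable (by simp) x
  have h1 := ((hd.hasFDerivAt.hasLineDerivAt (-e)).tendsto_slope_zero).comp
    (tendsto_div_two_pow hh₀)
  rw [map_neg] at h1
  refine h1.congr fun k ↦ ?_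
  simp only [Function.comp, diffPairing]
  generalize h₀ / 2 ^ k = h
  rw [moll, moll, ← integral_sub (integrable_mollKernel_smul hε hA hB _)
    (integrable_mollKernel_smul hε hA hB _), smul_eq_mul, ← integral_const_mul]
  congr 1 with y
  rw [smul_neg, ← sub_eq_add_neg, show x - h • e - y = x - (y + h • e) by abel]
  simp only [smul_eq_mul]
  ring

lemma YoungPair.sub_const {K : Set (EuclideanSpace ℝ (Fin n))} {e : EuclideanSpace ℝ (Fin n)}
    {h₀ α β a b : ℝ} {ψ A : EuclideanSpace ℝ (Fin n) → ℝ} (P : YoungPair K e h₀ α β a b ψ A)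
    (c : ℝ) : YoungPair K e h₀ α β a b ψ (fun x ↦ A x - c) :=
  { P with
    aesm := P.aesm.sub aestronglyMeasurable_const
    bdd := by
      obtain ⟨B, hB⟩ := P.bdd
      exact ⟨B + |c|, fun x ↦ (abs_sub _ _).trans (by gcongr; exact hB x)⟩
    incr_right := fun h hh x hx ↦ by
      simpa only [sub_sub_sub_cancel_right] using P.incr_right h hh x hx }

end Mollifier

section Bracket

variable {n : ℕ}

/-! ### Brackets of mollified fields -/

lemma cthickening_closedBall_eq {x : EuclideanSpace ℝ (Fin n)} {a b c : ℝ} (ha : 0 ≤ a)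
    (hb : 0 ≤ b) (hc : a + b = c) :
    Metric.cthickening a (Metric.closedBall x b) = Metric.closedBall x c := by
  rw [cthickening_closedBall ha hb, hc]

variable (n) in
/-- The constant of `IsProduct.abs_sub_le` for functions with Hölder bound `H`. -/
noncomputable def productConst (H : ℝ) : ℝ :=
  4 * H * bumpBound n * (2 ^ n * ballVol n) * (H * (1 / (1 - (1 / 2) ^ ((1 : ℝ) / 2)) + 3))

/-- A commutator estimate: mollifying the product `f ∂ᵢA` differs from multiplying `f` with the
mollification of `∂ᵢA` by `O(ε ^ (1 / 2))`. The difference is the pairing of `∂ᵢ(A - A x)` with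
`(f - f x) φ`, to which the Young estimate with exponents `3 / 4` applies at scale `ε`. -/
lemma IsProduct.abs_sub_le {Ω : Opens (EuclideanSpace ℝ (Fin n))}
    {f A : EuclideanSpace ℝ (Fin n) → ℝ} {i : Fin n} {T : 𝓓'(Ω, ℝ)}
    (hf : ∀ α ∈ Ioo (0 : ℝ) 1, ∃ C, 0 ≤ C ∧
      HolderBound (Ω : Set (EuclideanSpace ℝ (Fin n))) α f C)
    (hA : ∀ α ∈ Ioo (0 : ℝ) 1, ∃ C, 0 ≤ C ∧
      HolderBound (Ω : Set (EuclideanSpace ℝ (Fin n))) α A C)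
    (h : IsProduct Ω f (partialDeriv i (toDistribution Ω A)) T) {H : ℝ} (hH : 0 ≤ H)
    (hfH : HolderBound (Ω : Set (EuclideanSpace ℝ (Fin n))) (3 / 4) f H)
    (hAH : HolderBound (Ω : Set (EuclideanSpace ℝ (Fin n))) (3 / 4) A H)
    {ε : ℝ} (hε : 0 < ε) {x : EuclideanSpace ℝ (Fin n)}
    (hx : Metric.closedBall x (4 * ε) ⊆ Ω) (φ : 𝓓(Ω, ℝ))
    (hφ : ∀ y, φ y = mollKernel ε (x - y)) :
    |T φ - f x * fderiv ℝ (moll ε ((Ω : Set (EuclideanSpace ℝ (Fin n))).indicator A)) x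
      (EuclideanSpace.single i 1)| ≤ productConst n H * ε ^ ((1 : ℝ) / 2) := by
  set e : EuclideanSpace ℝ (Fin n) := EuclideanSpace.single i 1 with he_def
  have he : ‖e‖ ≤ 1 := by simp [he_def]
  have h34 : (3 / 4 : ℝ) ∈ Ioo (0 : ℝ) 1 := by norm_num
  have hxΩ : x ∈ (Ω : Set (EuclideanSpace ℝ (Fin n))) :=
    hx (Metric.mem_closedBall_self (by positivity))
  have hfc : ContinuousOn f Ω := hfH.continuousOn h34.1
  have hAc : ContinuousOn A Ω := hAH.continuousOn h34.1
  have hb := bumpBound_nonneg n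
  have hv : 0 ≤ ballVol n := measureReal_nonneg
  set A' := (Ω : Set (EuclideanSpace ℝ (Fin n))).indicator A with hA'
  have hA'm : AEStronglyMeasurable A' volume := aestronglyMeasurable_indicator Ω.isOpen hAc
  have hA'b : ∀ y, |A' y| ≤ H := fun y ↦ by
    by_cases hy : y ∈ (Ω : Set (EuclideanSpace ℝ (Fin n)))
    · rw [hA', indicator_of_mem hy]; exact hAH.1 y hy
    · rw [hA', indicator_of_notMem hy, abs_zero]; exact hH
  have hKc := isCompact_closedBall x ε
  have hφ0 : ∀ y ∉ Metric.closedBall x ε, φ y = 0 := fun y hy ↦ by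
    rw [hφ, mollKernel_sub_eq_zero hε hy]
  have hφK : tsupport φ ⊆ Metric.closedBall x ε :=
    closure_minimal (fun y hy ↦ by_contra fun h ↦ hy (hφ0 y h)) Metric.isClosed_closedBall
  have h3 : Metric.closedBall x (3 * ε) ⊆ Ω :=
    (Metric.closedBall_subset_closedBall (by linarith)).trans hx
  -- the pairing of `∂ᵢA` with `(f - f x) φ`, as a limit of difference quotients
  have hlim1 := h.tendsto_diffPairing hf hA φ hKc hφK hε
    ((cthickening_closedBall_eq (by positivity) hε.le (by ring)).trans_subset hx)
  have hlim2 := tendsto_diffPairing_mollKernel hε hA'm hA'b x e hε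
  have hfφ : Continuous fun y ↦ f y * φ y :=
    continuous_mul_of_tsupport_subset Ω.isOpen hfc φ.continuous φ.tsupport_subset
  have hgφ : Continuous fun y ↦ (f y - f x) * φ y :=
    continuous_mul_of_tsupport_subset Ω.isOpen (hfc.sub continuousOn_const) φ.continuous
      φ.tsupport_subset
  have hsplit : ∀ k : ℕ, diffPairing e (fun y ↦ (f y - f x) * φ y) A' (ε / 2 ^ k) =
      diffPairing e (fun y ↦ f y * φ y) A' (ε / 2 ^ k) -
        f x * diffPairing e (fun y ↦ mollKernel ε (x - y)) A' (ε / 2 ^ k) := by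
    intro k
    generalize ε / 2 ^ k = t
    have hi1 := integrable_diff_mul hfφ (HasCompactSupport.intro hKc fun y hy ↦ by
      rw [hφ0 y hy, mul_zero]) hA'm hA'b (t • e) 0 t
    have hi2 := integrable_diff_mul (continuous_mollKernel_sub ε x)
      (hasCompactSupport_mollKernel_sub hε x) hA'm hA'b (t • e) 0 t
    simp only [add_zero] at hi1 hi2
    rw [diffPairing, diffPairing, diffPairing, ← integral_const_mul,
      ← integral_sub hi1 (hi2.const_mul (f x))]
    congr 1 with y
    rw [← hφ, ← hφ]
    ring
  set l := -T φ - f x * -fderiv ℝ (moll ε A') x e with hl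
  have hlim : Tendsto (fun k : ℕ ↦ diffPairing e (fun y ↦ (f y - f x) * φ y) A' (ε / 2 ^ k))
      atTop (𝓝 l) := by
    simp only [hsplit]
    exact hlim1.sub (hlim2.const_mul (f x))
  have hdist : ∀ {r : ℝ} {y : EuclideanSpace ℝ (Fin n)}, y ∈ Metric.closedBall x (r * ε) →
      0 ≤ r → r ≤ 3 → ‖y - x‖ ^ (3 / 4 : ℝ) ≤ 3 * ε ^ (3 / 4 : ℝ) := by
    intro r y hy hr0 hr3
    have h1 : ‖y - x‖ ≤ 3 * ε :=
      (mem_closedBall_iff_norm.1 hy).trans (by gcongr)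
    calc ‖y - x‖ ^ (3 / 4 : ℝ) ≤ (3 * ε) ^ (3 / 4 : ℝ) := by gcongr
      _ = 3 ^ (3 / 4 : ℝ) * ε ^ (3 / 4 : ℝ) := Real.mul_rpow (by norm_num) hε.le
      _ ≤ 3 * ε ^ (3 / 4 : ℝ) := by
        gcongr
        simpa using Real.rpow_le_rpow_of_exponent_le (by norm_num : (1 : ℝ) ≤ 3)
          (by norm_num : (3 / 4 : ℝ) ≤ 1)
  set M := bumpBound n * (ε ^ n)⁻¹ with hM
  have hM0 : 0 ≤ M := by positivity
  have hP : YoungPair (Metric.closedBall x ε) e ε (3 / 4) (3 / 4)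
      (H * M + H * (3 * ε ^ (3 / 4 : ℝ)) * (M * ε⁻¹ * ε ^ (1 - 3 / 4 : ℝ))) H
      (fun y ↦ (f y - f x) * φ y) A' := by
    refine YoungPair.of_mul (S := Metric.closedBall x (3 * ε)) hKc he hε h34 h34
      (cthickening_closedBall_eq (by positivity) hε.le (by ring)).subset (by positivity) hH
      hM0 (by positivity) ?_ ?_ ?_ ?_ hφ0 hgφ hA'm ⟨H, hA'b⟩ hH ?_
    · intro y hy
      refine (hfH.2 y (h3 hy) x hxΩ).trans ?_
      gcongr
      exact hdist hy (by norm_num) le_rfl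
    · intro y hy z hz
      rw [sub_sub_sub_cancel_right]
      exact hfH.2 y (h3 hy) z (h3 hz)
    · intro y
      rw [hφ]; exact abs_mollKernel_le hε _
    · intro y z
      have := abs_mollKernel_sub_le hε (x - y) (x - z)
      rwa [sub_sub_sub_cancel_left, norm_sub_rev, ← hφ, ← hφ] at this
    · intro y hy z hz
      rw [hA', indicator_of_mem (h3 hy), indicator_of_mem (h3 hz)]
      exact hAH.2 y (h3 hy) z (h3 hz)
  set a := H * M + H * (3 * ε ^ (3 / 4 : ℝ)) * (M * ε⁻¹ * ε ^ (1 - 3 / 4 : ℝ)) with ha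
  have ha' : a = 4 * H * M := by
    have : ε ^ (3 / 4 : ℝ) * ε ^ (1 - 3 / 4 : ℝ) = ε := by
      rw [← Real.rpow_add hε]; norm_num
    have h5 : ε * ε⁻¹ = 1 := mul_inv_cancel₀ hε.ne'
    rw [ha]
    linear_combination 3 * H * M * ε⁻¹ * this + 3 * H * M * h5
  have hvol : (volume : Measure (EuclideanSpace ℝ (Fin n))).real
      (Metric.cthickening ε (Metric.closedBall x ε)) = 2 ^ n * ε ^ n * ballVol n := by
    rw [cthickening_closedBall_eq hε.le hε.le (two_mul ε).symm,
      volume_real_closedBall _ (by positivity), mul_pow]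
  have hexp : (3 / 4 + 3 / 4 - 1 : ℝ) = 1 / 2 := by norm_num
  have hb1 := hP.abs_diffPairing_sub_le_of_tendsto (by norm_num) hlim 0
  have hb2 := (hP.sub_const (A x)).abs_diffPairing_le (h := ε) (c := H * (3 * ε ^ (3 / 4 : ℝ)))
    ⟨hε, le_rfl⟩ (by positivity) (by
      intro y hy
      have hy2 : y ∈ Metric.closedBall x (2 * ε) := by
        rw [← cthickening_closedBall_eq hε.le hε.le (two_mul ε).symm]
        exact mem_cthickening_of_mem_or he hε.le le_rfl hy
      have hyΩ : y ∈ (Ω : Set (EuclideanSpace ℝ (Fin n))) :=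
        hx (Metric.closedBall_subset_closedBall (by linarith) hy2)
      rw [hA', indicator_of_mem hyΩ]
      refine (hAH.2 y hyΩ x hxΩ).trans ?_
      gcongr
      exact hdist hy2 (by norm_num) (by norm_num))
  rw [hP.diffPairing_sub_const] at hb2
  simp only [pow_zero, div_one, mul_one, hexp] at hb1
  rw [hvol] at hb1 hb2
  have h6 : |l| ≤ a * H * ε ^ ((1 : ℝ) / 2) * (2 ^ n * ε ^ n * ballVol n) /
      (1 - (1 / 2) ^ ((1 : ℝ) / 2)) +
        a * ε ^ (3 / 4 : ℝ) / ε * (H * (3 * ε ^ (3 / 4 : ℝ))) * (2 ^ n * ε ^ n * ballVol n) := by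
    have := abs_sub_abs_le_abs_sub l (diffPairing e (fun y ↦ (f y - f x) * φ y) A' ε)
    have h5 := abs_sub_comm l (diffPairing e (fun y ↦ (f y - f x) * φ y) A' ε)
    linarith
  have h7 : T φ - f x * fderiv ℝ (moll ε A') x e = -l := by rw [hl]; ring
  rw [h7, abs_neg]
  refine h6.trans (le_of_eq ?_)
  have h8 : ε ^ (3 / 4 : ℝ) / ε * ε ^ (3 / 4 : ℝ) = ε ^ ((1 : ℝ) / 2) := by
    rw [← hexp, Real.rpow_sub hε, Real.rpow_add hε, Real.rpow_one]
    ring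
  have h9 : (ε ^ n)⁻¹ * ε ^ n = 1 := inv_mul_cancel₀ (by positivity)
  have h10 : a * (2 ^ n * ε ^ n * ballVol n) = 4 * H * bumpBound n * (2 ^ n * ballVol n) := by
    rw [ha', hM]
    linear_combination 4 * H * bumpBound n * 2 ^ n * ballVol n * h9
  rw [productConst]
  calc _ = a * (2 ^ n * ε ^ n * ballVol n) * (H * (1 / (1 - (1 / 2) ^ ((1 : ℝ) / 2)))) *
        ε ^ ((1 : ℝ) / 2) + a * (2 ^ n * ε ^ n * ballVol n) * (H * 3) *
          (ε ^ (3 / 4 : ℝ) / ε * ε ^ (3 / 4 : ℝ)) := by ring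
    _ = _ := by rw [h8, h10]; ring

end Bracket

section MollifiedFields

variable {n : ℕ}

/-! ### Mollified log-Lipschitz fields -/

lemma etaLog_le_of_le {ε ρ : ℝ} (hε : 0 < ε) (hε1 : ε ≤ 1) (hρ : 0 ≤ ρ) (hρε : ρ ≤ 2 * ε) :
    etaLog ρ ≤ 2 * ε * (Real.log (1 / ε) + 1) := by
  have hlog : 0 ≤ Real.log (1 / ε) := Real.log_nonneg (by rwa [one_le_div hε])
  unfold etaLog
  split_ifs with h
  · rcases hρ.eq_or_lt with rfl | hρ
    · rw [zero_mul]
      positivity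
    have h1 : Real.log (1 / ρ) = Real.log (1 / ε) + Real.log (ε / ρ) := by
      rw [← Real.log_mul (by positivity) (by positivity)]
      congr 1
      field_simp
    have h2 : ρ * Real.log (ε / ρ) ≤ ε := by
      calc ρ * Real.log (ε / ρ) ≤ ρ * (ε / ρ) := by
            gcongr
            exact (Real.log_le_sub_one_of_pos (by positivity)).trans (by linarith)
        _ = ε := by field_simp
    have h3 := mul_le_mul_of_nonneg_right hρε hlog
    rw [h1]
    linarith
  · have h3 : 0 ≤ 2 * ε * Real.log (1 / ε) := by positivity
    linarith

/-- The scale `r e ^ (-N)` of the `N`-th mollification. -/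
noncomputable def mollScale (r : ℝ) (N : ℕ) : ℝ := r * Real.exp (-N)

lemma mollScale_pos {r : ℝ} (hr : 0 < r) (N : ℕ) : 0 < mollScale r N := by
  unfold mollScale; positivity

lemma mollScale_le {r : ℝ} (hr : 0 ≤ r) (N : ℕ) : mollScale r N ≤ r :=
  mul_le_of_le_one_right hr (Real.exp_le_one_iff.2 (by simp))

lemma mollScale_rpow_le {r a : ℝ} (hr : 0 < r) (hr1 : r ≤ 1) (ha : 0 ≤ a) (N : ℕ) :
    mollScale r N ^ a ≤ Real.exp (-(a * N)) := by
  calc mollScale r N ^ a ≤ Real.exp (-N) ^ a := by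
        refine Real.rpow_le_rpow (mollScale_pos hr N).le ?_ ha
        exact mul_le_of_le_one_left (Real.exp_nonneg _) hr1
    _ = Real.exp (-(a * N)) := by rw [← Real.exp_mul]; congr 1; ring

/-- The mollification at scale `r e ^ (-N)` of the extension by zero of a field on `Ω`. -/
noncomputable def mollField (Ω : Opens (EuclideanSpace ℝ (Fin n)))
    (X : EuclideanSpace ℝ (Fin n) → EuclideanSpace ℝ (Fin n)) (r : ℝ) (N : ℕ) :
    EuclideanSpace ℝ (Fin n) → EuclideanSpace ℝ (Fin n) :=
  moll (mollScale r N) ((Ω : Set (EuclideanSpace ℝ (Fin n))).indicator X)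

section Bounds

variable {Ω : Opens (EuclideanSpace ℝ (Fin n))}
  {X Y : EuclideanSpace ℝ (Fin n) → EuclideanSpace ℝ (Fin n)} {C r : ℝ}

lemma HolderBound.aestronglyMeasurable_indicator
    (h : HolderBound (Ω : Set (EuclideanSpace ℝ (Fin n))) (3 / 4) X C) :
    AEStronglyMeasurable ((Ω : Set (EuclideanSpace ℝ (Fin n))).indicator X) volume :=
  LogLipFlow.aestronglyMeasurable_indicator Ω.isOpen (h.continuousOn (by norm_num))

lemma HolderBound.norm_indicator_le (hC : 0 ≤ C)
    (h : HolderBound (Ω : Set (EuclideanSpace ℝ (Fin n))) (3 / 4) X C)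
    (x : EuclideanSpace ℝ (Fin n)) :
    ‖(Ω : Set (EuclideanSpace ℝ (Fin n))).indicator X x‖ ≤ C := by
  by_cases hx : x ∈ (Ω : Set (EuclideanSpace ℝ (Fin n)))
  · rw [indicator_of_mem hx]; exact h.1 x hx
  · rw [indicator_of_notMem hx, norm_zero]; exact hC

lemma HolderBound.contDiff_mollField (hC : 0 ≤ C)
    (h : HolderBound (Ω : Set (EuclideanSpace ℝ (Fin n))) (3 / 4) X C) (hr : 0 < r) (N : ℕ) :
    ContDiff ℝ ∞ (mollField Ω X r N) :=
  contDiff_moll (mollScale_pos hr N) h.aestronglyMeasurable_indicator (h.norm_indicator_le hC)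

lemma HolderBound.norm_mollField_sub_le (hC : 0 ≤ C)
    (h : HolderBound (Ω : Set (EuclideanSpace ℝ (Fin n))) (3 / 4) X C) (hr : 0 < r) (hr1 : r ≤ 1)
    (N : ℕ) {x : EuclideanSpace ℝ (Fin n)} (hx : Metric.closedBall x (4 * r) ⊆ Ω) :
    ‖mollField Ω X r N x - X x‖ ≤ C * Real.exp (-(3 / 4 * N)) := by
  refine norm_moll_sub_le (mollScale_pos hr N) h.aestronglyMeasurable_indicator
    (h.norm_indicator_le hC) fun y hy ↦ ?_
  have hyΩ := hx (Metric.closedBall_subset_closedBall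
    ((mollScale_le hr.le N).trans (by linarith)) hy)
  rw [indicator_of_mem hyΩ]
  refine (h.2 y hyΩ x (hx (Metric.mem_closedBall_self (by positivity)))).trans ?_
  gcongr
  refine le_trans ?_ (mollScale_rpow_le hr hr1 (by norm_num) N)
  gcongr
  exact mem_closedBall_iff_norm.1 hy

/-- The derivative of the `N`-th mollification of a log-Lipschitz field grows linearly in `N`. -/
lemma IsLogLipschitz.exists_norm_fderiv_mollField_le (hX : IsLogLipschitz Ω X) (hr : 0 < r)
    (hr1 : r ≤ 1) : ∃ C, 0 ≤ C ∧ HolderBound (Ω : Set (EuclideanSpace ℝ (Fin n))) (3 / 4) X C ∧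
      ∀ N : ℕ, ∀ x, Metric.closedBall x (4 * r) ⊆ Ω →
        ‖fderiv ℝ (mollField Ω X r N) x‖ ≤ C * (N + 1) := by
  obtain ⟨H, hH0, hH⟩ := hX.exists_holderBound (β := 3 / 4) (by norm_num)
  obtain ⟨C, -, hC⟩ := hX
  have hb := bumpBound_nonneg n
  have hv : 0 ≤ ballVol n := measureReal_nonneg
  have hlog : 0 ≤ Real.log (1 / r) := Real.log_nonneg (by rwa [one_le_div hr])
  set D := bumpBound n * 2 ^ n * ballVol n * (|C| * (2 * (Real.log (1 / r) + 1))) with hD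
  refine ⟨max H D, le_max_of_le_left hH0, hH.mono_const (le_max_left _ _), fun N x hx ↦ ?_⟩
  have hε := mollScale_pos hr N
  have hεr := mollScale_le hr.le N
  have hlogε : Real.log (1 / mollScale r N) = N + Real.log (1 / r) := by
    rw [mollScale, one_div, one_div, Real.log_inv, Real.log_inv,
      Real.log_mul hr.ne' (Real.exp_ne_zero _), Real.log_exp]
    ring
  have h1 : ‖fderiv ℝ (mollField Ω X r N) x‖ ≤ bumpBound n * 2 ^ n * ballVol n *
      (|C| * (2 * mollScale r N * (N + Real.log (1 / r) + 1)) / mollScale r N) := by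
    refine norm_fderiv_moll_le hε hH.aestronglyMeasurable_indicator (hH.norm_indicator_le hH0)
      (c := X x) (by positivity) fun y hy ↦ ?_
    have hyΩ := hx (Metric.closedBall_subset_closedBall (by linarith) hy)
    rw [indicator_of_mem hyΩ]
    refine (hC y hyΩ x (hx (Metric.mem_closedBall_self (by positivity)))).trans ?_
    have h2 := etaLog_le_of_le hε (hεr.trans hr1) (norm_nonneg (y - x))
      (mem_closedBall_iff_norm.1 hy)
    rw [hlogε] at h2
    exact mul_le_mul (le_abs_self C) h2 (etaLog_nonneg (norm_nonneg _)) (abs_nonneg C)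
  have h3 : |C| * (2 * mollScale r N * (N + Real.log (1 / r) + 1)) / mollScale r N =
      |C| * (2 * (N + Real.log (1 / r) + 1)) := by
    field_simp
  rw [h3] at h1
  calc _ ≤ _ := h1
    _ ≤ bumpBound n * 2 ^ n * ballVol n * (|C| * (2 * ((Real.log (1 / r) + 1) * (N + 1)))) := by
      gcongr
      nlinarith [mul_nonneg hlog (Nat.cast_nonneg (α := ℝ) N)]
    _ = D * (N + 1) := by rw [hD]; ring
    _ ≤ max H D * (N + 1) := by gcongr; exact le_max_right _ _

lemma logApprox_mollField (hC : 0 ≤ C)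
    (h : HolderBound (Ω : Set (EuclideanSpace ℝ (Fin n))) (3 / 4) X C) (hr : 0 < r) (hr1 : r ≤ 1)
    (hd : ∀ N : ℕ, ∀ x, Metric.closedBall x (4 * r) ⊆ Ω →
      ‖fderiv ℝ (mollField Ω X r N) x‖ ≤ C * (N + 1)) {S : Set (EuclideanSpace ℝ (Fin n))}
    (hS : Convex ℝ S) (hSΩ : ∀ x ∈ S, Metric.closedBall x (4 * r) ⊆ Ω) {C' : ℝ} (hCC' : C ≤ C') :
    LogApprox X S C' (mollField Ω X r) where
  nonneg := hC.trans hCC'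
  bound N x := (norm_moll_le (mollScale_pos hr N) h.aestronglyMeasurable_indicator
    (h.norm_indicator_le hC) x).trans hCC'
  lip N x hx y hy := by
    refine hS.norm_image_sub_le_of_norm_fderiv_le (𝕜 := ℝ)
      (fun z _ ↦ (h.contDiff_mollField hC hr N).differentiable (by simp) z) (fun z hz ↦ ?_) hy hx
    exact (hd N z (hSΩ z hz)).trans (by gcongr)
  close N x hx := by
    refine (h.norm_mollField_sub_le hC hr hr1 N (hSΩ x hx)).trans (mul_le_mul hCC'
      (Real.exp_le_exp.2 ?_) (Real.exp_nonneg _) (hC.trans hCC'))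
    linarith [Nat.cast_nonneg (α := ℝ) N]

lemma IsLogLipschitz.locallyLogApprox (hX : IsLogLipschitz Ω X) : LocallyLogApprox Ω X := by
  intro q hq
  obtain ⟨δ, hδ, hqΩ⟩ := Metric.nhds_basis_closedBall.mem_iff.1 (Ω.isOpen.mem_nhds hq)
  have hr : 0 < min 1 (δ / 8) := by positivity
  obtain ⟨C, hC, hH, hd⟩ := hX.exists_norm_fderiv_mollField_le hr (min_le_left _ _)
  refine ⟨δ / 2, by positivity, C, _, (Metric.closedBall_subset_closedBall (by linarith)).trans hqΩ,
    logApprox_mollField hC hH hr (min_le_left _ _) hd (convex_closedBall q (δ / 2))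
      (fun x hx ↦ (Metric.closedBall_subset_closedBall' ?_).trans hqΩ) le_rfl⟩
  linarith [min_le_right 1 (δ / 8), Metric.mem_closedBall.1 hx]

lemma fderiv_mollField_apply (hC : 0 ≤ C)
    (h : HolderBound (Ω : Set (EuclideanSpace ℝ (Fin n))) (3 / 4) X C) (hr : 0 < r) (N : ℕ)
    (x v : EuclideanSpace ℝ (Fin n)) (j : Fin n) :
    fderiv ℝ (mollField Ω X r N) x v j = ∑ i, v i * fderiv ℝ (moll (mollScale r N)
      ((Ω : Set (EuclideanSpace ℝ (Fin n))).indicator fun y ↦ X y j)) x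
        (EuclideanSpace.single i 1) := by
  have hε := mollScale_pos hr N
  let L : EuclideanSpace ℝ (Fin n) →L[ℝ] ℝ := EuclideanSpace.proj j
  have h1 : moll (mollScale r N) ((Ω : Set (EuclideanSpace ℝ (Fin n))).indicator fun y ↦ X y j) =
      fun z ↦ L (mollField Ω X r N z) := by
    ext1 z
    rw [mollField, moll, moll, ← L.integral_comp_comm (integrable_mollKernel_smul hε
      h.aestronglyMeasurable_indicator (h.norm_indicator_le hC) z)]
    congr 1 with y
    by_cases hy : y ∈ (Ω : Set (EuclideanSpace ℝ (Fin n)))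
    · simp [indicator_of_mem hy, L]
    · simp [indicator_of_notMem hy, L]
  have h2 : HasFDerivAt (fun z ↦ L (mollField Ω X r N z))
      (L.comp (fderiv ℝ (mollField Ω X r N) x)) x :=
    L.hasFDerivAt.comp x
      ((h.contDiff_mollField hC hr N).differentiable (by simp) x).hasFDerivAt
  rw [h1, h2.fderiv]
  conv_lhs => rw [← (EuclideanSpace.basisFun (Fin n) ℝ).sum_repr v]
  simp [L]

lemma norm_le_card_mul_of_abs_apply_le {v : EuclideanSpace ℝ (Fin n)} {c : ℝ}
    (h : ∀ j, |v j| ≤ c) : ‖v‖ ≤ n * c := by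
  rw [← (EuclideanSpace.basisFun (Fin n) ℝ).sum_repr v]
  refine (norm_sum_le_of_le (f := _) (n := fun _ ↦ c) _ fun j _ ↦ ?_).trans_eq (by simp)
  simpa [norm_smul] using h j

/-- If the distributional bracket of `X` and `Y` vanishes, testing it with the mollifying kernel
bounds the derivatives of the mollified fields along the original ones. -/
lemma IsLieBracket.norm_fderiv_mollField_sub_le (hX : IsLogLipschitz Ω X)
    (hY : IsLogLipschitz Ω Y) (hXY : IsLieBracket Ω X Y 0) (hC : 0 ≤ C)
    (hXH : HolderBound (Ω : Set (EuclideanSpace ℝ (Fin n))) (3 / 4) X C)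
    (hYH : HolderBound (Ω : Set (EuclideanSpace ℝ (Fin n))) (3 / 4) Y C) (hr : 0 < r)
    (hr1 : r ≤ 1) (N : ℕ) {x : EuclideanSpace ℝ (Fin n)}
    (hx : Metric.closedBall x (4 * r) ⊆ Ω) :
    ‖fderiv ℝ (mollField Ω Y r N) x (X x) - fderiv ℝ (mollField Ω X r N) x (Y x)‖ ≤
      n * (n * (2 * productConst n C)) * Real.exp (-(N / 2)) := by
  have hε := mollScale_pos hr N
  have hεr := mollScale_le hr.le N
  have hcomp : ∀ {Z : EuclideanSpace ℝ (Fin n) → EuclideanSpace ℝ (Fin n)},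
      IsLogLipschitz Ω Z → ∀ i, ∀ α ∈ Ioo (0 : ℝ) 1, ∃ C, 0 ≤ C ∧
        HolderBound (Ω : Set (EuclideanSpace ℝ (Fin n))) α (fun y ↦ Z y i) C := by
    intro Z hZ i α hα
    obtain ⟨C, h0, h1⟩ := hZ.exists_holderBound hα
    exact ⟨C, h0, h1.apply i⟩
  have hsupp : tsupport (fun y ↦ mollKernel (mollScale r N) (x - y)) ⊆ Ω := by
    have h : tsupport (fun y ↦ mollKernel (mollScale r N) (x - y)) ⊆
        Metric.closedBall x (mollScale r N) :=
      closure_minimal (fun y hy ↦ by_contra fun h ↦ hy (mollKernel_sub_eq_zero hε h))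
        Metric.isClosed_closedBall
    exact h.trans ((Metric.closedBall_subset_closedBall (by linarith)).trans hx)
  let φ : 𝓓(Ω, ℝ) := ⟨fun y ↦ mollKernel (mollScale r N) (x - y),
    (contDiff_mollKernel _).comp (contDiff_const.sub contDiff_id),
    hasCompactSupport_mollKernel_sub hε x, hsupp⟩
  have hx' : Metric.closedBall x (4 * mollScale r N) ⊆ Ω :=
    (Metric.closedBall_subset_closedBall (by linarith)).trans hx
  have hb := bumpBound_nonneg n
  have hv : 0 ≤ ballVol n := measureReal_nonneg
  have hexp : mollScale r N ^ ((1 : ℝ) / 2) ≤ Real.exp (-(N / 2)) :=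
    (mollScale_rpow_le hr hr1 (by norm_num) N).trans_eq (by congr 1; ring)
  have hlt : (1 / 2 : ℝ) ^ ((1 : ℝ) / 2) ≤ 1 := Real.rpow_le_one (by norm_num) (by norm_num)
    (by norm_num)
  have hK : 0 ≤ productConst n C := by
    have : 0 ≤ 1 / (1 - (1 / 2 : ℝ) ^ ((1 : ℝ) / 2)) := div_nonneg zero_le_one (by linarith)
    unfold productConst
    positivity
  rw [mul_assoc]
  refine norm_le_card_mul_of_abs_apply_le fun j ↦ ?_
  obtain ⟨P, Q, hP, hQ, h0⟩ := hXY j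
  have h1 : ∑ i, (P i φ - Q i φ) = 0 := by
    have := DFunLike.congr_fun h0 φ
    simpa using this.symm
  have h2 : (fderiv ℝ (mollField Ω Y r N) x (X x) - fderiv ℝ (mollField Ω X r N) x (Y x)) j =
      -∑ i, ((P i φ - X x i * fderiv ℝ (moll (mollScale r N)
        ((Ω : Set (EuclideanSpace ℝ (Fin n))).indicator fun y ↦ Y y j)) x
          (EuclideanSpace.single i 1)) - (Q i φ - Y x i * fderiv ℝ (moll (mollScale r N)
        ((Ω : Set (EuclideanSpace ℝ (Fin n))).indicator fun y ↦ X y j)) x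
          (EuclideanSpace.single i 1))) := by
    rw [PiLp.sub_apply, fderiv_mollField_apply hC hYH hr, fderiv_mollField_apply hC hXH hr]
    simp only [Finset.sum_sub_distrib] at h1 ⊢
    linarith
  rw [h2, abs_neg]
  refine (Finset.abs_sum_le_sum_abs _ _).trans ?_
  calc _ ≤ ∑ _i : Fin n, 2 * productConst n C * Real.exp (-(N / 2)) := by
        refine Finset.sum_le_sum fun i _ ↦ (abs_sub _ _).trans ?_
        have hp := (hP i).abs_sub_le (hcomp hX i) (hcomp hY j) hC (hXH.apply i) (hYH.apply j) hε
          hx' φ fun _ ↦ rfl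
        have hq := (hQ i).abs_sub_le (hcomp hY i) (hcomp hX j) hC (hYH.apply i) (hXH.apply j) hε
          hx' φ fun _ ↦ rfl
        have := mul_le_mul_of_nonneg_left hexp hK
        linarith
    _ = _ := by simp; ring

/-- The bracket of the mollified fields is small. The linear growth in `N` of their derivatives is
absorbed by the surplus decay `e ^ (-N / 4)` of the approximation error. -/
lemma IsLieBracket.norm_bracket_mollField_le (hX : IsLogLipschitz Ω X)
    (hY : IsLogLipschitz Ω Y) (hXY : IsLieBracket Ω X Y 0) (hC : 0 ≤ C)
    (hXH : HolderBound (Ω : Set (EuclideanSpace ℝ (Fin n))) (3 / 4) X C)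
    (hYH : HolderBound (Ω : Set (EuclideanSpace ℝ (Fin n))) (3 / 4) Y C) (hr : 0 < r)
    (hr1 : r ≤ 1) (N : ℕ) {x : EuclideanSpace ℝ (Fin n)}
    (hx : Metric.closedBall x (4 * r) ⊆ Ω)
    (hXd : ‖fderiv ℝ (mollField Ω X r N) x‖ ≤ C * (N + 1))
    (hYd : ‖fderiv ℝ (mollField Ω Y r N) x‖ ≤ C * (N + 1)) :
    ‖fderiv ℝ (mollField Ω Y r N) x (mollField Ω X r N x) -
      fderiv ℝ (mollField Ω X r N) x (mollField Ω Y r N x)‖ ≤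
        (n * (n * (2 * productConst n C)) + 8 * C ^ 2) * Real.exp (-(N / 2)) := by
  have h1 := hXY.norm_fderiv_mollField_sub_le hX hY hC hXH hYH hr hr1 N hx
  have h2 := hXH.norm_mollField_sub_le hC hr hr1 N hx
  have h3 := hYH.norm_mollField_sub_le hC hr hr1 N hx
  set DX := fderiv ℝ (mollField Ω X r N) x
  set DY := fderiv ℝ (mollField Ω Y r N) x
  have h4 : ((N : ℝ) + 1) * Real.exp (-(3 / 4 * N)) ≤ 4 * Real.exp (-(N / 2)) := by
    have h5 : (N : ℝ) + 1 ≤ 4 * Real.exp (N / 4) := by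
      linarith [Real.add_one_le_exp ((N : ℝ) / 4), Nat.cast_nonneg (α := ℝ) N]
    calc _ ≤ 4 * Real.exp (N / 4) * Real.exp (-(3 / 4 * N)) := by gcongr
      _ = 4 * Real.exp (-(N / 2)) := by rw [mul_assoc, ← Real.exp_add]; congr 2; ring
  have h6 : ∀ {D : EuclideanSpace ℝ (Fin n) →L[ℝ] EuclideanSpace ℝ (Fin n)}
      {v : EuclideanSpace ℝ (Fin n)}, ‖D‖ ≤ C * (N + 1) → ‖v‖ ≤ C * Real.exp (-(3 / 4 * N)) →
        ‖D v‖ ≤ 4 * C ^ 2 * Real.exp (-(N / 2)) := by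
    intro D v hD hv
    calc ‖D v‖ ≤ C * (N + 1) * (C * Real.exp (-(3 / 4 * N))) := D.le_of_opNorm_le_of_le hD hv
      _ = C ^ 2 * ((N + 1) * Real.exp (-(3 / 4 * N))) := by ring
      _ ≤ C ^ 2 * (4 * Real.exp (-(N / 2))) := by gcongr
      _ = _ := by ring
  have h7 : DY (mollField Ω X r N x) - DX (mollField Ω Y r N x) =
      (DY (X x) - DX (Y x)) + DY (mollField Ω X r N x - X x) -
        DX (mollField Ω Y r N x - Y x) := by
    rw [map_sub, map_sub]; abel
  rw [h7]
  calc _ ≤ ‖DY (X x) - DX (Y x)‖ + ‖DY (mollField Ω X r N x - X x)‖ +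
        ‖DX (mollField Ω Y r N x - Y x)‖ := (norm_sub_le _ _).trans (by gcongr; exact norm_add_le _ _)
    _ ≤ n * (n * (2 * productConst n C)) * Real.exp (-(N / 2)) +
        4 * C ^ 2 * Real.exp (-(N / 2)) + 4 * C ^ 2 * Real.exp (-(N / 2)) := by
      gcongr
      · exact h6 hYd h2
      · exact h6 hXd h3
    _ = _ := by ring

end Bounds

end MollifiedFields

end LogLipFlow


theorem proposition3p17 (n : ℕ) (Ω U : TopologicalSpace.Opens (EuclideanSpace ℝ (Fin n)))
    (hU : LogLipFlow.CompactlyInside U Ω)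
    (X Y : EuclideanSpace ℝ (Fin n) → EuclideanSpace ℝ (Fin n))
    (hX : LogLipFlow.IsLogLipschitz Ω X) (hY : LogLipFlow.IsLogLipschitz Ω Y)
    (hXY : LogLipFlow.IsLieBracket Ω X Y 0) :
    ∃ ε₀ : ℝ, 0 < ε₀ ∧ ∀ t s : ℝ, |t| < ε₀ → |s| < ε₀ → ∀ p ∈ U,
      ((s, p) ∈ LogLipFlow.flowDomain Ω Y ∧
        (t, LogLipFlow.flow Ω Y s p) ∈ LogLipFlow.flowDomain Ω X) ∧
      ((t, p) ∈ LogLipFlow.flowDomain Ω X ∧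
        (s, LogLipFlow.flow Ω X t p) ∈ LogLipFlow.flowDomain Ω Y) ∧
      LogLipFlow.flow Ω X t (LogLipFlow.flow Ω Y s p) ∈ Ω ∧
      LogLipFlow.flow Ω X t (LogLipFlow.flow Ω Y s p) =
        LogLipFlow.flow Ω Y s (LogLipFlow.flow Ω X t p) := by
  obtain ⟨δ, hδ, hδΩ⟩ := hU.1.exists_cthickening_subset_open Ω.isOpen hU.2
  -- the balls of the flow argument have radius `4 R`, and mollification needs another `4 R`
  set R := min 1 (δ / 8)
  have hR : 0 < R := by positivity
  have hR1 : R ≤ 1 := min_le_left _ _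
  have hRδ : 8 * R ≤ δ := by linarith [min_le_right 1 (δ / 8)]
  have hball : ∀ p ∈ U, ∀ x ∈ Metric.closedBall p (4 * R), Metric.closedBall x (4 * R) ⊆ Ω := by
    intro p hp x hx
    refine Subset.trans (Metric.closedBall_subset_closedBall' ?_)
      ((Metric.closedBall_subset_cthickening (subset_closure hp) δ).trans hδΩ)
    linarith [Metric.mem_closedBall.1 hx]
  obtain ⟨CX, hCX, hXH, hXd⟩ := hX.exists_norm_fderiv_mollField_le hR hR1
  obtain ⟨CY, -, hYH, hYd⟩ := hY.exists_norm_fderiv_mollField_le hR hR1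
  set C := max CX CY
  have hC : 0 ≤ C := le_max_of_le_left hCX
  replace hXH := hXH.mono_const (le_max_left CX CY)
  replace hYH := hYH.mono_const (le_max_right CX CY)
  replace hXd : ∀ N : ℕ, ∀ x, Metric.closedBall x (4 * R) ⊆ Ω →
      ‖fderiv ℝ (LogLipFlow.mollField Ω X R N) x‖ ≤ C * (N + 1) := fun N x hx ↦
    (hXd N x hx).trans (by gcongr; exact le_max_left _ _)
  replace hYd : ∀ N : ℕ, ∀ x, Metric.closedBall x (4 * R) ⊆ Ω →
      ‖fderiv ℝ (LogLipFlow.mollField Ω Y R N) x‖ ≤ C * (N + 1) := fun N x hx ↦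
    (hYd N x hx).trans (by gcongr; exact le_max_right _ _)
  set K := n * (n * (2 * LogLipFlow.productConst n C)) + 8 * C ^ 2
  -- `C + 1` keeps the constant positive, so that the time bound can be divided by it
  set M := max (C + 1) K
  have hCM : C ≤ M := le_max_of_le_left (by linarith)
  have hM : 0 < M := lt_of_lt_of_le (by linarith) (le_max_left (C + 1) K)
  refine ⟨min (R / M) (1 / 32 / M), by positivity, fun t s ht hs p hp ↦ ?_⟩
  refine LogLipFlow.LogApprox.flow_commute hR (hball p hp p (Metric.mem_closedBall_self
    (by positivity))) hX.locallyLogApprox hY.locallyLogApprox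
    (LogLipFlow.logApprox_mollField hC hXH hR hR1 hXd (convex_closedBall _ _) (hball p hp) hCM)
    (LogLipFlow.logApprox_mollField hC hYH hR hR1 hYd (convex_closedBall _ _) (hball p hp) hCM)
    (fun N ↦ mod_cast contDiff_infty.1 (hXH.contDiff_mollField hC hR N) 2)
    (fun N ↦ mod_cast contDiff_infty.1 (hYH.contDiff_mollField hC hR N) 2)
    (fun N x hx ↦ ?_) ?_ ?_ (abs_lt.1 ht) (abs_lt.1 hs)
  · have hxΩ := hball p hp x hx
    refine (hXY.norm_bracket_mollField_le hX hY hC hXH hYH hR hR1 N hxΩ (hXd N x hxΩ)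
      (hYd N x hxΩ)).trans ?_
    gcongr
    exact le_max_right _ _
  · rw [mul_comm, ← le_div_iff₀ hM]; exact min_le_left _ _
  · rw [mul_comm, ← le_div_iff₀ hM]; exact min_le_right _ _
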